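/- Let $(z,w)=z_1\bar w_1+z_2\bar w_2$ be the Hermitian product of $\mathbb C^2$, $\langle\,,\rangle=\mathrm{Re}(\,,)$ the Euclidean metric and $J$ multiplication by $i$. An immersion $\phi:M\to\mathbb C^2$ of a smooth surface is Lagrangian if $\mathrm{Im}(d\phi(v),d\phi(w))=0$ for all tangent vectors $v,w$ at a common point; it is a translating soliton for mean curvature flow with translating vector ${\bf e}\in\mathbb C^2\setminus\{0\}$ if its mean curvature vector $H$ (the trace of the second fundamental form) equals the normal component ${\bf e}^\perp$ of ${\bf e}$. **Theorem 1.** Let $\phi:M\to\mathbb C^2$ be a smooth Lagrangian translating soliton for mean curvature flow with translating vector ${\bf e}$, and let $z=x+iy$ be a local isothermal coordinate for the induced metric, on an open set $U\subset M$, such that the complex function $(\phi,{\bf e})$ satisfies $\frac{\partial^2}{\partial x\,\partial y}(\phi,{\bf e})=0$ on $U$. Then around every point of $U$, up to a dilation, a unitary motion of $\mathbb C^2$ (a unitary map followed by a translation) and a smooth change of coordinates, $\phi$ is one of the following: (i) the product $(s,t)\mapsto(\gamma(s),t)$ of the grim-reaper curve $\gamma(s)=\log\cosh s+2i\arctan(\tanh(s/2))$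 and a straight line; (ii) the product $(s_1,s_2)\mapsto(a_1\gamma(s_1),a_2\gamma(s_2))$ of two grim-reaper curves, with dilation factors $a_1,a_2>0$; (iii) an example $\alpha*\omega:I_1\times I_2\to\mathbb C^2$ for some $\varphi\in[0,\pi)$, where $I_1,I_2\subset\mathbb R$ are open intervals and $\alpha=\alpha(t)$, $t\in I_1$, and $\omega=\omega(s)$, $s\in I_2$, are smooth unit speed curves in $\mathbb C$ whose curvature vectors are $$\vec\kappa_\alpha=-\cos\varphi\,\alpha^\perp+\sin\varphi\,(J\alpha)^\perp,\qquad \vec\kappa_\omega=\cos\varphi\,\omega^\perp-\sin\varphi\,(J\omega)^\perp$$ ($\perp$ denotes the normal component along the curve), $\arg\alpha'$ and $\arg\dot\omega$ are continuous determinations, and $$(\alpha*\omega)(t,s)=\Big(\tfrac{|\omega(s)|^2-|\alpha(t)|^2}{2\cos\varphi}+(\tan\varphi-i)\big(\arg\alpha'(t)+\arg\dot\omega(s)\big),\ \alpha(t)\,\omega(s)\Big)\quad\text{if }\varphi\ne\pi/2,$$ $$(\alpha*\omega)(t,s)=\Big(\int_{t_0}^t\langle\alpha',J\alpha\rangle\,dx-\int_{s_0}^s\langle\dot\omega,J\omega\rangle\,dy-i\big(\arg\alpha'(t)+\arg\dot\omega(s)\big),\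 \alpha(t)\,\omega(s)\Big)\quad\text{if }\varphi=\pi/2,$$ with $t_0\in I_1$, $s_0\in I_2$. -/

import Mathlib

open scoped Manifold ContDiff ComplexConjugate

noncomputable section

namespace LagrangianSoliton

/-- The complex Euclidean plane `ℂ²`. -/
abbrev C2 : Type := EuclideanSpace ℂ (Fin 2)

/-- The real coordinate plane, with coordinates `u 0` and `u 1`. -/
abbrev R2 : Type := EuclideanSpace ℝ (Fin 2)

/-- The Hermitian product `(z, w) = z₁ w̄₁ + z₂ w̄₂`
(Mathlib's inner product is conjugate-linear in its first argument). -/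
def herm (z w : C2) : ℂ := inner ℂ w z

/-- The Euclidean metric `⟨z, w⟩ = Re (z, w)` of `ℂ²`. -/
def euc (z w : C2) : ℝ := (herm z w).re

/-- The Kähler two-form `-Im (z, w)` of `ℂ²`. -/
def kaehler (z w : C2) : ℝ := -(herm z w).im

/-- The partial derivative of `f` with respect to the `i`-th coordinate of the plane. -/
def pd {F : Type*} [NormedAddCommGroup F] [NormedSpace ℝ F] (i : Fin 2) (f : R2 → F) (u : R2) : F :=
  fderiv ℝ f u (EuclideanSpace.single i (1 : ℝ))

/-! ### Local differential geometry of a parametrized surface `X` in `ℂ²` -/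

/-- The matrix `(g i j)` of the induced metric. -/
def metric (X : R2 → C2) (u : R2) : Matrix (Fin 2) (Fin 2) ℝ :=
  Matrix.of fun i j => euc (pd i X u) (pd j X u)

/-- The normal component of the vector `v`: `v - ∑ g^{ij} ⟨v, ∂ᵢX⟩ ∂ⱼX`. -/
def normalPart (X : R2 → C2) (u : R2) (v : C2) : C2 :=
  v - ∑ i, ∑ j, ((metric X u)⁻¹ i j * euc v (pd i X u)) • pd j X u

/-- The mean curvature vector, the (unnormalized) trace of the second fundamental form:
`H = ∑ g^{ij} (∂ᵢ∂ⱼX)^⊥`. -/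
def meanCurvature (X : R2 → C2) (u : R2) : C2 :=
  ∑ i, ∑ j, (metric X u)⁻¹ i j • normalPart X u (pd i (pd j X) u)

/-! ### Immersed surfaces -/

section Surfaces

variable {M : Type*} [TopologicalSpace M] [ChartedSpace R2 M]

/-- A smooth Lagrangian immersion of the surface `M` into `ℂ²`. -/
structure IsLagrangianImmersion (φ : M → C2) : Prop where
  smooth : ContMDiff (𝓡 2) 𝓘(ℝ, C2) ∞ φ
  immersion : ∀ p : M, Function.Injective (mfderiv (𝓡 2) 𝓘(ℝ, C2) φ p)
  lagrangian : ∀ (p : M) (v w : TangentSpace (𝓡 2) p),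
    kaehler (mfderiv (𝓡 2) 𝓘(ℝ, C2) φ p v) (mfderiv (𝓡 2) 𝓘(ℝ, C2) φ p w) = 0

/-- `φ` is a translating soliton for mean curvature flow with translating vector `e`: the vector
`e` is nonzero and `H = e^⊥`, an equation computed in local coordinates of `M`. -/
structure IsTranslatingSoliton (φ : M → C2) (e : C2) : Prop where
  ne_zero : e ≠ 0
  eq : ∀ c ∈ IsManifold.maximalAtlas (𝓡 2) ∞ M, ∀ u ∈ c.target,
    meanCurvature (φ ∘ c.symm) u = normalPart (φ ∘ c.symm) u e

/-- `z = x + iy` is a local isothermal coordinate for the metric induced by `φ`. -/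
structure IsIsothermal (φ : M → C2) (z : OpenPartialHomeomorph M R2) : Prop where
  mem_atlas : z ∈ IsManifold.maximalAtlas (𝓡 2) ∞ M
  norm_eq : ∀ u ∈ z.target, metric (φ ∘ z.symm) u 0 0 = metric (φ ∘ z.symm) u 1 1
  orthogonal : ∀ u ∈ z.target, metric (φ ∘ z.symm) u 0 1 = 0

/-- Near `p`, and up to dilations, `φ` is congruent to the parametrized surface `E` with parameter
domain `D`: there are a smooth coordinate `Θ` around `p` with values in `D`, a factor `r > 0`,
a unitary map `U` and a vector `b` such that `φ = r U (E ∘ Θ) + b` around `p`. -/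
def LocallyCongruentAt (φ : M → C2) (p : M) (D : Set R2) (E : R2 → C2) : Prop :=
  ∃ Θ ∈ IsManifold.maximalAtlas (𝓡 2) ∞ M, p ∈ Θ.source ∧ Θ.target ⊆ D ∧
    ∃ (r : ℝ) (U : C2 ≃ₗᵢ[ℂ] C2) (b : C2), 0 < r ∧
      ∀ q ∈ Θ.source, φ q = r • U (E (Θ q)) + b

end Surfaces

/-! ### The examples -/

/-- The grim-reaper curve `(log cosh s, 2 arctan (tanh (s/2)))`, parametrized by arc length. -/
def grimReaper (s : ℝ) : ℂ :=
  ⟨Real.log (Real.cosh s), 2 * Real.arctan (Real.tanh (s / 2))⟩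

/-- The product of the grim-reaper curve and a straight line. -/
def grimReaperLine (u : R2) : C2 := !₂[grimReaper (u 0), (u 1 : ℂ)]

/-- The product of two grim-reaper curves, dilated by the factors `a₁` and `a₂`. -/
def grimReaperProduct (a₁ a₂ : ℝ) (u : R2) : C2 :=
  !₂[a₁ • grimReaper (u 0), a₂ • grimReaper (u 1)]

/-- The Euclidean inner product of `ℂ = ℝ²`. -/
def dot (v w : ℂ) : ℝ := (v * conj w).re

/-- The component of `v` normal to the unit vector `T`. -/
def normalComp (T v : ℂ) : ℂ := v - dot v T • T

/-- `c` is a smooth unit speed planar curve on the open interval `I`, with curvature vector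
`c'' = a c^⊥ + b (J c)^⊥`, and `ϑ` is a continuous determination of `arg c'` on `I`. -/
structure IsSolitonCurve (a b : ℝ) (I : Set ℝ) (c : ℝ → ℂ) (ϑ : ℝ → ℝ) : Prop where
  isOpen : IsOpen I
  ordConnected : I.OrdConnected
  smooth : ContDiffOn ℝ ∞ c I
  unit_speed : ∀ t ∈ I, ‖deriv c t‖ = 1
  curvature : ∀ t ∈ I, deriv (deriv c) t =
    a • normalComp (deriv c t) (c t) + b • normalComp (deriv c t) (Complex.I * c t)
  angle_continuous : ContinuousOn ϑ I
  angle : ∀ t ∈ I, deriv c t = Complex.exp (ϑ t * Complex.I)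

open Classical in
/-- The map `α ∗ w`, `u = (t, s)`, for the parameter `ϕ`; `ξ` and `ϑ` are the arguments of `α'` and
`w'`, and `t₀`, `s₀` are base points, used for `ϕ = π / 2` only. -/
def starMap (ϕ : ℝ) (α w : ℝ → ℂ) (ξ ϑ : ℝ → ℝ) (t₀ s₀ : ℝ) (u : R2) : C2 :=
  if ϕ = Real.pi / 2 then
    !₂[((∫ x in t₀..u 0, dot (deriv α x) (Complex.I * α x) : ℝ) : ℂ)
        - ((∫ y in s₀..u 1, dot (deriv w y) (Complex.I * w y) : ℝ) : ℂ)
        - Complex.I * ((ξ (u 0) + ϑ (u 1) : ℝ) : ℂ),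
      α (u 0) * w (u 1)]
  else
    !₂[(((‖w (u 1)‖ ^ 2 - ‖α (u 0)‖ ^ 2) / (2 * Real.cos ϕ) : ℝ) : ℂ)
        + ((Real.tan ϕ : ℂ) - Complex.I) * ((ξ (u 0) + ϑ (u 1) : ℝ) : ℂ),
      α (u 0) * w (u 1)]

end LagrangianSoliton

end

open LagrangianSoliton

namespace LagrangianSoliton

/-! Write `X` for the immersion in the isothermal chart, `e'` for a vector orthogonal to `e` of the
same length, and `F = (X, e)`, `ψ = (X, e')`. Lagrangian and isothermal together say that `X_x`,
`X_y` are Hermitian-orthogonal of equal length, so the matrix with rows `(F_x, ψ_x)`, `(F_y, ψ_y)`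
is a positive multiple of a unitary one. Hence `(ψ_x, ψ_y) = l (-conj F_y, conj F_x)` with `|l| = 1`
(`unitary_phase`): the whole surface is governed by `F` and the phase `l`.

Since `J X_x`, `J X_y` span the normal plane, `H = e^⊥` amounts to two real equations. Combined with
`ψ_xy = ψ_yx` and `F_xy = 0`, they give `dl = -i l d(Im F)` and `ΔF + i (Im F_x · F_x + Im F_y ·
F_y) = 0` (`phase_derivative`).

Separation gives `F = f(x) + g(y)` near a point, so the last equation splits: `f'' + i (Im f') f'`
is a constant `μ`, and the same expression in `g` is `-μ`. Moreover `l = c exp(-i Im f) exp(-i Im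
g)` (`exists_profiles`). The key object is the amplitude `A_f = exp(-i Im f) conj f'`, whose
derivative is `conj μ exp(-i Im f)`.

If `μ ≠ 0`, the gradient of `ψ` is a constant multiple of that of `A_f A_g`, so `ψ` is this product
up to constants. After rescaling, the amplitudes are unit speed curves with the required curvature,
and `f`, `g` can be recovered from them: this is `α ∗ w`.

If `μ = 0`, the amplitudes are constant and `X` is, up to constants, `h(x) V + k(y) W` with `V`, `W`
orthogonal of equal length and `h`, `k` primitives of the two phases. Each of `h`, `k` is a straight
line or a grim reaper (`eq_grimReaper`). Two lines give a plane, which belongs to the family `α ∗ w`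
through the complex squaring map. -/

/-- Two orthonormal vectors of `ℂ²` are the images of the standard basis under a unitary map. -/
theorem exists_unitary {v w : C2} (hv : ‖v‖ = 1) (hw : ‖w‖ = 1) (hvw : inner ℂ v w = 0) :
    ∃ U : C2 ≃ₗᵢ[ℂ] C2, ∀ a b : ℂ, U !₂[a, b] = a • v + b • w := by
  have hon : Orthonormal ℂ ![v, w] := by
    rw [orthonormal_iff_ite]
    intro i j
    have h3 : inner ℂ w v = 0 := inner_eq_zero_symm.mp hvw
    fin_cases i <;> fin_cases j <;> simp [h3, hvw, inner_self_eq_norm_sq_to_K, hv, hw]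
  have hcard : Fintype.card (Fin 2) = Module.finrank ℂ C2 := by simp
  let b := (basisOfOrthonormalOfCardEqFinrank hon hcard).toOrthonormalBasis (by simpa using hon)
  refine ⟨b.repr.symm, fun x y => ?_⟩
  rw [← OrthonormalBasis.sum_repr_symm]
  simp [b, Fin.sum_univ_two]

/-! ### Local congruence and the immersion read in a chart -/

variable {M : Type*} [TopologicalSpace M] [ChartedSpace R2 M]

/-- The new chart is `z` followed by `G`. With an explicit smooth inverse `K` on the open set `N`,
the image of `G` is `N ∩ K⁻¹ S`, which is open by continuity of `K`; no inverse function theorem is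
needed. -/
theorem locallyCongruentAt_of_coordinate [IsManifold (𝓡 2) ∞ M] {φ : M → C2}
    {z : OpenPartialHomeomorph M R2} (hz : z ∈ IsManifold.maximalAtlas (𝓡 2) ∞ M)
    {p : M} (hp : p ∈ z.source) {D S N : Set R2} {E G K : R2 → _}
    (hS : IsOpen S) (hpS : z p ∈ S) (hN : IsOpen N) (hND : N ⊆ D)
    (hG : ContDiffOn ℝ ∞ G S) (hK : ContDiffOn ℝ ∞ K N) (hGN : ∀ u ∈ S, G u ∈ N)
    (hKG : ∀ u ∈ S, K (G u) = u) (hGK : ∀ v ∈ N, K v ∈ S → G (K v) = v)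
    (r : ℝ) (hr : 0 < r) (U : C2 ≃ₗᵢ[ℂ] C2) (b : C2)
    (h : ∀ u ∈ S, φ (z.symm u) = r • U (E (G u)) + b) :
    LocallyCongruentAt φ p D E := by
  let L : OpenPartialHomeomorph R2 R2 :=
    { toFun := G
      invFun := K
      source := S
      target := N ∩ K ⁻¹' S
      map_source' := fun u hu => ⟨hGN u hu, by simpa [hKG u hu] using hu⟩
      map_target' := fun v hv => hv.2
      left_inv' := hKG
      right_inv' := fun v hv => hGK v hv.1 hv.2
      open_source := hS
      open_target := hK.continuousOn.isOpen_inter_preimage hN hS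
      continuousOn_toFun := hG.continuousOn
      continuousOn_invFun := hK.continuousOn.mono Set.inter_subset_left }
  have hz1 := contMDiffOn_of_mem_maximalAtlas hz
  have hz2 := contMDiffOn_symm_of_mem_maximalAtlas hz
  refine ⟨z.trans L, ?_, ?_, ?_, r, U, b, hr, ?_⟩
  · apply OpenPartialHomeomorph.mem_maximalAtlas_of_contMDiffOn
    · rw [OpenPartialHomeomorph.coe_trans]
      refine ContMDiffOn.comp (t := S) (contMDiffOn_iff_contDiffOn.mpr hG)
        (hz1.mono fun q hq => hq.1) fun q hq => hq.2
    · rw [OpenPartialHomeomorph.coe_trans_symm]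
      refine ContMDiffOn.comp (t := z.target) hz2
        (contMDiffOn_iff_contDiffOn.mpr (hK.mono fun v hv => ?_)) fun v hv => hv.2
      exact hv.1.1
  · exact ⟨hp, hpS⟩
  · intro v hv
    exact hND hv.1.1
  · intro q hq
    have h1 : z q ∈ S := hq.2
    have := h (z q) h1
    rwa [z.left_inv hq.1] at this

theorem fderiv_comp_symm [IsManifold (𝓡 2) ∞ M] {φ : M → C2}
    (hφ : ContMDiff (𝓡 2) 𝓘(ℝ, C2) ∞ φ)
    {z : OpenPartialHomeomorph M R2} (hz : z ∈ IsManifold.maximalAtlas (𝓡 2) ∞ M)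
    {u : R2} (hu : u ∈ z.target) :
    fderiv ℝ (φ ∘ z.symm) u =
      (mfderiv (𝓡 2) 𝓘(ℝ, C2) φ (z.symm u)).comp (mfderiv (𝓡 2) (𝓡 2) z.symm u) := by
  rw [← mfderiv_eq_fderiv]
  refine mfderiv_comp u (hφ.mdifferentiable (by simp) _) ?_
  exact (contMDiffAt_symm_of_mem_maximalAtlas hz hu).mdifferentiableAt (by simp)

theorem contDiffOn_comp_symm {φ : M → C2} [IsManifold (𝓡 2) ∞ M]
    (hφ : ContMDiff (𝓡 2) 𝓘(ℝ, C2) ∞ φ)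
    {z : OpenPartialHomeomorph M R2} (hz : z ∈ IsManifold.maximalAtlas (𝓡 2) ∞ M) :
    ContDiffOn ℝ ∞ (φ ∘ z.symm) z.target := by
  rw [← contMDiffOn_iff_contDiffOn]
  exact hφ.comp_contMDiffOn (contMDiffOn_symm_of_mem_maximalAtlas hz)

theorem fderiv_comp_symm_injective [IsManifold (𝓡 2) ∞ M] {φ : M → C2}
    (hφ : IsLagrangianImmersion φ)
    {z : OpenPartialHomeomorph M R2} (hz : z ∈ IsManifold.maximalAtlas (𝓡 2) ∞ M)
    {u : R2} (hu : u ∈ z.target) : Function.Injective (fderiv ℝ (φ ∘ z.symm) u) := by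
  rw [fderiv_comp_symm hφ.smooth hz hu]
  intro v w hvw
  replace hvw : mfderiv (𝓡 2) (𝓡 2) z.symm u v = mfderiv (𝓡 2) (𝓡 2) z.symm u w :=
    hφ.immersion _ hvw
  have h1 : MDifferentiableAt (𝓡 2) (𝓡 2) z.symm u :=
    (contMDiffAt_symm_of_mem_maximalAtlas hz hu).mdifferentiableAt (by simp)
  have h2 : MDifferentiableAt (𝓡 2) (𝓡 2) z (z.symm u) :=
    (contMDiffAt_of_mem_maximalAtlas hz (z.map_target hu)).mdifferentiableAt (by simp)
  have h3 : (mfderiv (𝓡 2) (𝓡 2) z (z.symm u)).comp (mfderiv (𝓡 2) (𝓡 2) z.symm u) =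
      ContinuousLinearMap.id ℝ _ := by
    rw [← mfderiv_comp u h2 h1, ← mfderiv_id]
    apply Filter.EventuallyEq.mfderiv_eq
    filter_upwards [z.open_target.mem_nhds hu] with v hv
    exact z.right_inv hv
  have h4 := congrArg (mfderiv (𝓡 2) (𝓡 2) z (z.symm u)) hvw
  exact (DFunLike.congr_fun h3 v).symm.trans (h4.trans (DFunLike.congr_fun h3 w))

theorem kaehler_pd_comp_symm [IsManifold (𝓡 2) ∞ M] {φ : M → C2}
    (hφ : IsLagrangianImmersion φ)
    {z : OpenPartialHomeomorph M R2} (hz : z ∈ IsManifold.maximalAtlas (𝓡 2) ∞ M)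
    {u : R2} (hu : u ∈ z.target) (i j : Fin 2) :
    kaehler (pd i (φ ∘ z.symm) u) (pd j (φ ∘ z.symm) u) = 0 := by
  unfold pd
  rw [fderiv_comp_symm hφ.smooth hz hu]
  exact hφ.lagrangian _ _ _

/-! ### Partial derivatives -/

section PartialDerivatives

variable {V W : Type*} [NormedAddCommGroup V] [NormedSpace ℝ V]
  [NormedAddCommGroup W] [NormedSpace ℝ W]

theorem pd_clm (L : V →L[ℝ] W) {f : R2 → V} {u : R2} (hf : DifferentiableAt ℝ f u) (i : Fin 2) :
    pd i (fun v => L (f v)) u = L (pd i f u) := by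
  unfold pd
  have h : fderiv ℝ (fun v => L (f v)) u = L.comp (fderiv ℝ f u) :=
    (L.hasFDerivAt.comp u hf.hasFDerivAt).fderiv
  rw [h]
  rfl

theorem pd_congr {f g : R2 → V} {T : Set R2} (hT : IsOpen T) (h : ∀ v ∈ T, f v = g v)
    {u : R2} (hu : u ∈ T) (i : Fin 2) : pd i f u = pd i g u := by
  unfold pd
  rw [Filter.EventuallyEq.fderiv_eq]
  filter_upwards [hT.mem_nhds hu] with v hv using h v hv

theorem contDiffOn_pd {f : R2 → V} {T : Set R2} (hT : IsOpen T) (hf : ContDiffOn ℝ ∞ f T)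
    (i : Fin 2) : ContDiffOn ℝ ∞ (pd i f) T :=
  (hf.fderiv_of_isOpen hT (by simp)).clm_apply contDiffOn_const

theorem ContDiffOn.differentiableAt_of_isOpen {f : R2 → V} {T : Set R2} (hf : ContDiffOn ℝ ∞ f T)
    (hT : IsOpen T) {u : R2} (hu : u ∈ T) : DifferentiableAt ℝ f u :=
  (hf.contDiffAt (hT.mem_nhds hu)).differentiableAt (by simp)

theorem pd_comm {f : R2 → V} {T : Set R2} (hT : IsOpen T) (hf : ContDiffOn ℝ ∞ f T)
    {u : R2} (hu : u ∈ T) (i j : Fin 2) : pd i (pd j f) u = pd j (pd i f) u := by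
  have h1 : ContDiffAt ℝ ∞ f u := hf.contDiffAt (hT.mem_nhds hu)
  have h2 : DifferentiableAt ℝ (fderiv ℝ f) u :=
    (h1.fderiv_right (m := ∞) (by simp)).differentiableAt (by simp)
  have h3 : ∀ k l : Fin 2, pd k (pd l f) u =
      fderiv ℝ (fderiv ℝ f) u (EuclideanSpace.single k 1) (EuclideanSpace.single l 1) :=
    fun k l => pd_clm (ContinuousLinearMap.apply ℝ V (EuclideanSpace.single l (1 : ℝ))) h2 k
  rw [h3, h3]
  exact (h1.isSymmSndFDerivAt
    (by simpa using WithTop.coe_le_coe.mpr (le_top : (2 : ℕ∞) ≤ ⊤))) _ _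

theorem pd_mul {f g : R2 → ℂ} {u : R2} (hf : DifferentiableAt ℝ f u) (hg : DifferentiableAt ℝ g u)
    (i : Fin 2) : pd i (fun v => f v * g v) u = pd i f u * g u + f u * pd i g u := by
  unfold pd
  rw [fderiv_fun_mul hf hg]
  simp; ring

theorem pd_neg {f : R2 → ℂ} {u : R2} (i : Fin 2) : pd i (fun v => -f v) u = -pd i f u := by
  unfold pd
  rw [fderiv_fun_neg]
  simp

theorem pd_const (c : V) (u : R2) (i : Fin 2) : pd i (fun _ => c) u = 0 := by
  simp [pd]

theorem pd_conj {f : R2 → ℂ} {u : R2} (hf : DifferentiableAt ℝ f u)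
    (i : Fin 2) : pd i (fun v => conj (f v)) u = conj (pd i f u) :=
  pd_clm (Complex.conjCLE : ℂ →L[ℝ] ℂ) hf i

end PartialDerivatives

/-! ### The coordinates of a soliton along and across the translating vector -/

/-- A vector orthogonal to `e` and of the same length. -/
def crossVector (e : C2) : C2 := !₂[-conj (e 1), conj (e 0)]

theorem herm_apply (z w : C2) : herm z w = z 0 * conj (w 0) + z 1 * conj (w 1) := by
  simp [herm, PiLp.inner_apply, Fin.sum_univ_two]

/-- Parseval's identity in the orthogonal basis `e`, `crossVector e`, whose members have equal
length; multiplying by `‖e‖ ^ 2` avoids normalizing. -/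
theorem norm_sq_mul_herm (e v w : C2) : (‖e‖ ^ 2 : ℝ) * herm v w =
    herm v e * conj (herm w e) + herm v (crossVector e) * conj (herm w (crossVector e)) := by
  rw [EuclideanSpace.norm_sq_eq]
  simp only [herm_apply, crossVector, Fin.sum_univ_two, ← Complex.normSq_eq_norm_sq,
    Complex.ofReal_add, ← Complex.mul_conj]
  simp
  ring

theorem norm_sq_smul_eq (e v : C2) : (‖e‖ ^ 2 : ℝ) • v =
    herm v e • e + herm v (crossVector e) • crossVector e := by
  rw [EuclideanSpace.norm_sq_eq]
  ext i
  simp only [herm_apply, crossVector, Fin.sum_univ_two, ← Complex.normSq_eq_norm_sq,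
    PiLp.smul_apply, Complex.real_smul,
    Complex.ofReal_add, ← Complex.mul_conj]
  fin_cases i <;> simp <;> ring

/-- The equations satisfied on `T` by the two coordinates `F = (X, e)` and `ψ = (X, e')` of a
Lagrangian translating soliton `X` in isothermal coordinates separating `F`. -/
structure IsSeparatedPair (T : Set R2) (F ψ : R2 → ℂ) : Prop where
  isOpen : IsOpen T
  smooth_fst : ContDiffOn ℝ ∞ F T
  smooth_snd : ContDiffOn ℝ ∞ ψ T
  orthogonal : ∀ u ∈ T, pd 0 F u * conj (pd 1 F u) + pd 0 ψ u * conj (pd 1 ψ u) = 0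
  conformal : ∀ u ∈ T, Complex.normSq (pd 0 F u) + Complex.normSq (pd 0 ψ u) =
    Complex.normSq (pd 1 F u) + Complex.normSq (pd 1 ψ u)
  pos : ∀ u ∈ T, 0 < Complex.normSq (pd 0 F u) + Complex.normSq (pd 0 ψ u)
  soliton_zero : ∀ u ∈ T, ((pd 0 (pd 0 F) u + pd 1 (pd 1 F) u) * conj (pd 0 F u) +
    (pd 0 (pd 0 ψ) u + pd 1 (pd 1 ψ) u) * conj (pd 0 ψ u)).im =
    -(Complex.normSq (pd 0 F u) + Complex.normSq (pd 0 ψ u)) * (pd 0 F u).im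
  soliton_one : ∀ u ∈ T, ((pd 0 (pd 0 F) u + pd 1 (pd 1 F) u) * conj (pd 1 F u) +
    (pd 0 (pd 0 ψ) u + pd 1 (pd 1 ψ) u) * conj (pd 1 ψ u)).im =
    -(Complex.normSq (pd 0 F u) + Complex.normSq (pd 0 ψ u)) * (pd 1 F u).im
  separated : ∀ u ∈ T, pd 0 (pd 1 F) u = 0

theorem herm_add_left (v w x : C2) : herm (v + w) x = herm v x + herm w x := by
  simp [herm_apply]; ring

theorem herm_sub_left (v w x : C2) : herm (v - w) x = herm v x - herm w x := by
  simp [herm_apply]; ring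

theorem herm_smul_left (r : ℝ) (v x : C2) : herm (r • v) x = r * herm v x := by
  simp [herm_apply]; ring

theorem conj_herm (v w : C2) : conj (herm v w) = herm w v := by
  simp [herm_apply]; ring

theorem herm_self (v : C2) : herm v v = (euc v v : ℝ) := by
  apply Complex.ext <;> simp [herm_apply, euc]; ring

theorem metric_eq {X : R2 → C2} {u : R2} (h : herm (pd 0 X u) (pd 1 X u) = 0)
    (h' : euc (pd 0 X u) (pd 0 X u) = euc (pd 1 X u) (pd 1 X u)) :
    metric X u = euc (pd 0 X u) (pd 0 X u) • (1 : Matrix (Fin 2) (Fin 2) ℝ) := by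
  have h2 : herm (pd 1 X u) (pd 0 X u) = 0 := by rw [← conj_herm, h, map_zero]
  ext i j
  fin_cases i <;> fin_cases j <;> simp [metric, ← h'] <;> simp [euc, h, h2]

theorem inv_metric_eq {X : R2 → C2} {u : R2} (h : herm (pd 0 X u) (pd 1 X u) = 0)
    (h' : euc (pd 0 X u) (pd 0 X u) = euc (pd 1 X u) (pd 1 X u))
    (h0 : euc (pd 0 X u) (pd 0 X u) ≠ 0) :
    (metric X u)⁻¹ = (euc (pd 0 X u) (pd 0 X u))⁻¹ • (1 : Matrix (Fin 2) (Fin 2) ℝ) := by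
  rw [metric_eq h h']
  apply Matrix.inv_eq_right_inv
  simp [smul_smul, h0]

/-- The equation `H = e^⊥` in an isothermal chart, tested against `J X_i`. -/
theorem im_herm_laplacian {X : R2 → C2} {u : R2} {e : C2}
    (h : herm (pd 0 X u) (pd 1 X u) = 0)
    (h' : euc (pd 0 X u) (pd 0 X u) = euc (pd 1 X u) (pd 1 X u))
    (h0 : euc (pd 0 X u) (pd 0 X u) ≠ 0) (hs : meanCurvature X u = normalPart X u e) (i : Fin 2) :
    (herm (pd 0 (pd 0 X) u + pd 1 (pd 1 X) u) (pd i X u)).im =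
      euc (pd 0 X u) (pd 0 X u) * (herm e (pd i X u)).im := by
  have h2 : herm (pd 1 X u) (pd 0 X u) = 0 := by rw [← conj_herm, h, map_zero]
  -- The normal part differs from `v` by real multiples of `∂ⱼX`, and each `(∂ⱼX, ∂ᵢX)` is real, so
  -- the imaginary part does not see the projection.
  have hn : ∀ v, (herm (normalPart X u v) (pd i X u)).im = (herm v (pd i X u)).im := by
    intro v
    unfold normalPart
    rw [inv_metric_eq h h' h0]
    fin_cases i <;>
    simp [Fin.sum_univ_two, herm_sub_left, herm_add_left, herm_smul_left, h, h2, herm_self]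
  have h3 := congrArg (fun v => (herm v (pd i X u)).im) hs
  unfold meanCurvature at h3
  rw [inv_metric_eq h h' h0] at h3
  simp [Fin.sum_univ_two, herm_add_left, herm_smul_left, hn] at h3
  rw [herm_add_left, Complex.add_im, ← h3]
  field_simp

theorem exists_hermCLM (x : C2) : ∃ L : C2 →L[ℝ] ℂ, ∀ v, herm v x = L v :=
  ⟨(innerSL ℂ x).restrictScalars ℝ, fun v => by simp [herm]⟩

/-- Pairing with a fixed vector is real linear, so it commutes with partial derivatives. Each
equation for `X` then becomes one for its two coordinates by Parseval, with the factor `‖e‖ ^ 2`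
absorbed in the metric coefficient. -/
theorem isSeparatedPair_of_soliton [IsManifold (𝓡 2) ∞ M]
    {φ : M → C2} {e : C2} (hφ : IsLagrangianImmersion φ) (hsol : IsTranslatingSoliton φ e)
    {z : OpenPartialHomeomorph M R2} (hz : IsIsothermal φ z)
    (hsep : ∀ u ∈ z.target, pd 0 (pd 1 (fun v => herm (φ (z.symm v)) e)) u = 0) :
    IsSeparatedPair z.target (fun v => herm (φ (z.symm v)) e)
      (fun v => herm (φ (z.symm v)) (crossVector e)) := by
  have hT := z.open_target
  have hX := contDiffOn_comp_symm hφ.smooth hz.mem_atlas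
  have hn : 0 < ‖e‖ ^ 2 := by have := norm_pos_iff.mpr hsol.ne_zero; positivity
  set X := φ ∘ z.symm with hXdef
  have key : ∀ x : C2, ContDiffOn ℝ ∞ (fun v => herm (φ (z.symm v)) x) z.target ∧
      (∀ u ∈ z.target, ∀ i, pd i (fun v => herm (φ (z.symm v)) x) u = herm (pd i X u) x) ∧
      (∀ u ∈ z.target, ∀ i j, pd i (pd j (fun v => herm (φ (z.symm v)) x)) u =
        herm (pd i (pd j X) u) x) := by
    intro x
    obtain ⟨L, hL⟩ := exists_hermCLM x
    simp only [hL]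
    have h1 : ∀ u ∈ z.target, ∀ i, pd i (fun v => L (φ (z.symm v))) u = L (pd i X u) :=
      fun u hu i => pd_clm L (hX.differentiableAt_of_isOpen hT hu) i
    refine ⟨L.contDiff.comp_contDiffOn hX, h1, fun u hu i j => ?_⟩
    rw [pd_congr hT (fun v hv => h1 v hv j) hu]
    exact pd_clm L ((contDiffOn_pd hT hX j).differentiableAt_of_isOpen hT hu) i
  obtain ⟨hF, hF1, hF2⟩ := key e
  obtain ⟨hψ, hψ1, hψ2⟩ := key (crossVector e)
  have ho : ∀ u ∈ z.target, herm (pd 0 X u) (pd 1 X u) = 0 := by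
    intro u hu
    have h1 := kaehler_pd_comp_symm hφ hz.mem_atlas hu 0 1
    have h2 := hz.orthogonal u hu
    simp only [metric, Matrix.of_apply, euc] at h2
    simp only [kaehler, neg_eq_zero] at h1
    exact Complex.ext h2 h1
  have hc : ∀ u ∈ z.target, euc (pd 0 X u) (pd 0 X u) = euc (pd 1 X u) (pd 1 X u) :=
    fun u hu => hz.norm_eq u hu
  have hpos : ∀ u ∈ z.target, 0 < euc (pd 0 X u) (pd 0 X u) := by
    intro u hu
    have h1 : euc (pd 0 X u) (pd 0 X u) = ‖pd 0 X u‖ ^ 2 := by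
      rw [euc, herm, inner_self_eq_norm_sq_to_K]
      norm_cast
    have h2 : pd 0 X u ≠ 0 := by
      intro h
      have := fderiv_comp_symm_injective hφ hz.mem_atlas hu (h.trans (map_zero _).symm)
      simp at this
    rw [h1]
    have := norm_pos_iff.mpr h2
    positivity
  have hE : ∀ u i, Complex.normSq (herm (pd i X u) e) +
      Complex.normSq (herm (pd i X u) (crossVector e)) =
      ‖e‖ ^ 2 * euc (pd i X u) (pd i X u) := by
    intro u i
    have h := norm_sq_mul_herm e (pd i X u) (pd i X u)
    rw [Complex.mul_conj, Complex.mul_conj, herm_self] at h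
    exact_mod_cast h.symm
  have hsl : ∀ u ∈ z.target, ∀ i, (herm (pd 0 (pd 0 X) u + pd 1 (pd 1 X) u) e *
      conj (herm (pd i X u) e) + herm (pd 0 (pd 0 X) u + pd 1 (pd 1 X) u) (crossVector e) *
      conj (herm (pd i X u) (crossVector e))).im =
      -(‖e‖ ^ 2 * euc (pd 0 X u) (pd 0 X u)) * (herm (pd i X u) e).im := by
    intro u hu i
    rw [← norm_sq_mul_herm, Complex.im_ofReal_mul,
      im_herm_laplacian (ho u hu) (hc u hu) (hpos u hu).ne' (hsol.eq z hz.mem_atlas u hu),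
      ← conj_herm _ e]
    simp
    ring
  refine ⟨hT, hF, hψ, ?_, ?_, ?_, ?_, ?_, hsep⟩
  · intro u hu
    rw [hF1 u hu, hF1 u hu, hψ1 u hu, hψ1 u hu, ← norm_sq_mul_herm, ho u hu, mul_zero]
  · intro u hu
    rw [hF1 u hu, hF1 u hu, hψ1 u hu, hψ1 u hu, hE, hE, hc u hu]
  · intro u hu
    rw [hF1 u hu, hψ1 u hu, hE]
    exact mul_pos hn (hpos u hu)
  · intro u hu
    rw [hF1 u hu, hψ1 u hu, hE, hF2 u hu, hF2 u hu, hψ2 u hu, hψ2 u hu, ← herm_add_left,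
      ← herm_add_left]
    exact hsl u hu 0
  · intro u hu
    rw [hF1 u hu, hψ1 u hu, hF1 u hu, hψ1 u hu, hE, hF2 u hu, hF2 u hu, hψ2 u hu, hψ2 u hu,
      ← herm_add_left, ← herm_add_left]
    exact hsl u hu 1

/-- The rows `(p, a)`, `(q, b)` form a positive multiple of a unitary matrix, and `l` is its
normalized determinant. The second column of a unitary matrix is determined by the first and the
determinant. -/
theorem unitary_phase {p q a b : ℂ} (h : p * conj q + a * conj b = 0)
    (h' : Complex.normSq p + Complex.normSq a = Complex.normSq q + Complex.normSq b)
    (h0 : 0 < Complex.normSq p + Complex.normSq a) {l : ℂ}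
    (hl : l = (p * b - q * a) / (Complex.normSq p + Complex.normSq a : ℝ)) :
    l * conj l = 1 ∧ a = -l * conj q ∧ b = l * conj p := by
  have hE : ((Complex.normSq p + Complex.normSq a : ℝ) : ℂ) ≠ 0 := by exact_mod_cast h0.ne'
  have e1 : ((Complex.normSq p + Complex.normSq a : ℝ) : ℂ) = p * conj p + a * conj a := by
    simp [Complex.mul_conj]
  have e2 : ((Complex.normSq p + Complex.normSq a : ℝ) : ℂ) = q * conj q + b * conj b := by
    rw [h']; simp [Complex.mul_conj]
  have h2 : conj p * q + conj a * b = 0 := by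
    have := congrArg conj h
    simpa using this
  set E : ℂ := ((Complex.normSq p + Complex.normSq a : ℝ) : ℂ) with hEdef
  have hcE : conj E = E := Complex.conj_ofReal _
  refine ⟨?_, ?_, ?_⟩
  · rw [hl, map_div₀, hcE]
    field_simp
    simp only [map_sub, map_mul]
    rw [sq]
    nth_rw 1 [e1]
    rw [e2]
    linear_combination (-h2) * (p * conj q + a * conj b)
  · rw [hl]
    field_simp
    linear_combination a * e2 + b * h
  · rw [hl]
    field_simp
    linear_combination b * e1 + a * h2

/-- The derivatives of the phase, from the compatibility and curvature equations. -/
theorem phase_derivative {p q l l0 l1 s t a00 a11 : ℂ} {m n : ℝ} (hl : l * conj l = 1)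
    (hl0 : l0 = Complex.I * m * l) (hl1 : l1 = Complex.I * n * l)
    (hc : l1 * conj q + l * conj t + l0 * conj p + l * conj s = 0)
    (h00 : a00 = -l0 * conj q) (h11 : a11 = l1 * conj p)
    (hE : 0 < Complex.normSq p + Complex.normSq q)
    (hs0 : ((s + t) * conj p + (a00 + a11) * conj (-l * conj q)).im =
      -(Complex.normSq p + Complex.normSq q) * p.im)
    (hs1 : ((s + t) * conj q + (a00 + a11) * conj (l * conj p)).im =
      -(Complex.normSq p + Complex.normSq q) * q.im) :
    m = -p.im ∧ n = -q.im ∧ s + t = Complex.I * (n * q + m * p) := by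
  have hl2 : l ≠ 0 := by rintro rfl; simp at hl
  -- Here `p`, `q`, `s`, `t` stand for `F_x`, `F_y`, `F_xx`, `F_yy`, and `l0`, `l1` for the
  -- derivatives of the phase. The hypothesis `hc` is `ψ_xy = ψ_yx`, and dividing it by `l` gives
  -- the Laplacian of `F`.
  have hst : s + t = Complex.I * (n * q + m * p) := by
    have h1 : l * (conj (s + t) + Complex.I * (n * conj q + m * conj p)) = 0 := by
      rw [map_add]; linear_combination hc + conj q * (-hl1) + conj p * (-hl0)
    have h2 := (mul_eq_zero.mp h1).resolve_left hl2
    have h3 := congrArg conj h2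
    simp at h3
    linear_combination h3
  refine ⟨?_, ?_, hst⟩
  -- The two mixed terms carrying `n` cancel, one coming from `ΔF` and one from `Δψ`; what remains
  -- is `i m` times the metric coefficient.
  · have h1 : (s + t) * conj p + (a00 + a11) * conj (-l * conj q) =
        Complex.I * ((m * (Complex.normSq p + Complex.normSq q) : ℝ) : ℂ) +
          Complex.I * n * (q * conj p - conj p * q) := by
      rw [hst, h00, h11, hl0, hl1]
      simp only [map_mul, map_neg, Complex.conj_conj, Complex.ofReal_mul, Complex.ofReal_add,
        ← Complex.mul_conj]
      linear_combination (Complex.I * m * conj q * q - Complex.I * n * conj p * q) * hl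
    rw [h1] at hs0
    have h2 : m * (Complex.normSq p + Complex.normSq q) =
      -(Complex.normSq p + Complex.normSq q) * p.im := by
      rw [← hs0, mul_comm q, sub_self]; simp
    nlinarith [mul_left_cancel₀ hE.ne' (show (Complex.normSq p + Complex.normSq q) * m =
      (Complex.normSq p + Complex.normSq q) * -p.im by linarith)]
  · have h1 : (s + t) * conj q + (a00 + a11) * conj (l * conj p) =
        Complex.I * ((n * (Complex.normSq p + Complex.normSq q) : ℝ) : ℂ) +
          Complex.I * m * (p * conj q - conj q * p) := by
      rw [hst, h00, h11, hl0, hl1]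
      simp only [map_mul, Complex.conj_conj, Complex.ofReal_mul, Complex.ofReal_add,
        ← Complex.mul_conj]
      linear_combination (-Complex.I * m * conj q * p + Complex.I * n * conj p * p) * hl
    rw [h1] at hs1
    have h2 : n * (Complex.normSq p + Complex.normSq q) =
      -(Complex.normSq p + Complex.normSq q) * q.im := by
      rw [← hs1, mul_comm p, sub_self]; simp
    nlinarith [mul_left_cancel₀ hE.ne' (show (Complex.normSq p + Complex.normSq q) * n =
      (Complex.normSq p + Complex.normSq q) * -q.im by linarith)]

theorem exists_real_of_unit {l l' : ℂ} (hl : l * conj l = 1)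
    (h : l' * conj l + l * conj l' = 0) : ∃ m : ℝ, l' = Complex.I * m * l := by
  refine ⟨(l' * conj l).im, ?_⟩
  have h1 : l' * conj l = Complex.I * (l' * conj l).im := by
    apply Complex.ext
    · have := congrArg Complex.re h
      simp at this ⊢
      linarith
    · simp
  rw [← h1]
  linear_combination -l' * hl

/-- The phase `l` of a separated pair: `(ψ_x, ψ_y) = l (-conj F_y, conj F_x)`. -/
theorem IsSeparatedPair.exists_phase {T : Set R2} {F ψ : R2 → ℂ} (h : IsSeparatedPair T F ψ) :
    ∃ l : R2 → ℂ, ∀ u ∈ T, DifferentiableAt ℝ l u ∧ l u * conj (l u) = 1 ∧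
      pd 0 ψ u = -l u * conj (pd 1 F u) ∧ pd 1 ψ u = l u * conj (pd 0 F u) ∧
      pd 0 l u = -Complex.I * (pd 0 F u).im * l u ∧
      pd 1 l u = -Complex.I * (pd 1 F u).im * l u ∧
      pd 0 (pd 0 F) u + Complex.I * (pd 0 F u).im * pd 0 F u +
        (pd 1 (pd 1 F) u + Complex.I * (pd 1 F u).im * pd 1 F u) = 0 := by
  have hT := h.isOpen
  have dF : ∀ i, ∀ u ∈ T, DifferentiableAt ℝ (pd i F) u := fun i u hu =>
    (contDiffOn_pd hT h.smooth_fst i).differentiableAt_of_isOpen hT hu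
  have dψ : ∀ i, ∀ u ∈ T, DifferentiableAt ℝ (pd i ψ) u := fun i u hu =>
    (contDiffOn_pd hT h.smooth_snd i).differentiableAt_of_isOpen hT hu
  obtain ⟨l, hl⟩ : ∃ l : R2 → ℂ, ∀ u, l u = (pd 0 F u * pd 1 ψ u - pd 1 F u * pd 0 ψ u) /
    (Complex.normSq (pd 0 F u) + Complex.normSq (pd 0 ψ u) : ℝ) := ⟨_, fun _ => rfl⟩
  have hph := fun u (hu : u ∈ T) =>
    unitary_phase (h.orthogonal u hu) (h.conformal u hu) (h.pos u hu) (hl u)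
  have hdl : ∀ u ∈ T, DifferentiableAt ℝ l u := by
    intro u hu
    have h1 : l = fun u => (pd 0 F u * pd 1 ψ u - pd 1 F u * pd 0 ψ u) /
        (pd 0 F u * conj (pd 0 F u) + pd 0 ψ u * conj (pd 0 ψ u)) := by
      funext u
      rw [hl, Complex.mul_conj, Complex.mul_conj]
      norm_cast
    have h2 : pd 0 F u * conj (pd 0 F u) + pd 0 ψ u * conj (pd 0 ψ u) ≠ 0 := by
      rw [Complex.mul_conj, Complex.mul_conj]
      exact_mod_cast (h.pos u hu).ne'
    have d1 := dF 0 u hu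
    have d2 := dF 1 u hu
    have d3 := dψ 0 u hu
    have d4 := dψ 1 u hu
    have c1 : DifferentiableAt ℝ (fun v => conj (pd 0 F v)) u :=
      (Complex.conjCLE : ℂ →L[ℝ] ℂ).differentiableAt.comp u d1
    have c3 : DifferentiableAt ℝ (fun v => conj (pd 0 ψ v)) u :=
      (Complex.conjCLE : ℂ →L[ℝ] ℂ).differentiableAt.comp u d3
    rw [h1]
    simp only [div_eq_mul_inv]
    exact ((d1.fun_mul d4).fun_sub (d2.fun_mul d3)).fun_mul
      (((d1.fun_mul c1).fun_add (d3.fun_mul c3)).fun_inv h2)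
  refine ⟨l, fun u hu => ?_⟩
  obtain ⟨h1, h2, h3⟩ := hph u hu
  have cdiff : ∀ {f : R2 → ℂ}, DifferentiableAt ℝ f u →
      DifferentiableAt ℝ (fun v => conj (f v)) u := fun hf =>
    (Complex.conjCLE : ℂ →L[ℝ] ℂ).differentiableAt.comp u hf
  -- Differentiating `l * conj l = 1` makes `l' * conj l` purely imaginary.
  have hreal : ∀ i, ∃ m : ℝ, pd i l u = Complex.I * m * l u := by
    intro i
    refine exists_real_of_unit h1 ?_
    rw [← pd_conj (hdl u hu), ← pd_mul (hdl u hu) (cdiff (hdl u hu)),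
      pd_congr hT (fun v hv => (hph v hv).1) hu, pd_const]
  obtain ⟨m, hm⟩ := hreal 0
  obtain ⟨n, hn⟩ := hreal 1
  have hψ0 : ∀ i, pd i (pd 0 ψ) u =
      -(pd i l u * conj (pd 1 F u) + l u * conj (pd i (pd 1 F) u)) := by
    intro i
    rw [pd_congr (g := fun v => -(l v * conj (pd 1 F v))) hT
      (fun v hv => by rw [(hph v hv).2.1]; ring) hu, pd_neg,
      pd_mul (hdl u hu) (cdiff (dF 1 u hu)), pd_conj (dF 1 u hu)]
  have hψ1 : ∀ i, pd i (pd 1 ψ) u =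
      pd i l u * conj (pd 0 F u) + l u * conj (pd i (pd 0 F) u) := by
    intro i
    rw [pd_congr hT (fun v hv => (hph v hv).2.2) hu, pd_mul (hdl u hu) (cdiff (dF 0 u hu)),
      pd_conj (dF 0 u hu)]
  have hF01 := h.separated u hu
  have hF10 : pd 1 (pd 0 F) u = 0 := by rw [pd_comm hT h.smooth_fst hu, hF01]
  have hcomp := pd_comm hT h.smooth_snd hu 1 0
  rw [hψ0, hψ1] at hcomp
  have hnorm : Complex.normSq (pd 0 ψ u) = Complex.normSq (pd 1 F u) := by
    have hl1 : Complex.normSq (l u) = 1 := by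
      rw [Complex.mul_conj] at h1; exact_mod_cast h1
    rw [h2, Complex.normSq_mul, Complex.normSq_neg, hl1, Complex.normSq_conj, one_mul]
  have hpos := h.pos u hu
  have hs0 := h.soliton_zero u hu
  have hs1 := h.soliton_one u hu
  have h00 := hψ0 0
  have h11 := hψ1 1
  rw [hF01, map_zero, mul_zero, add_zero] at h00
  rw [hF10, map_zero, mul_zero, add_zero] at h11
  rw [hnorm] at hpos hs0 hs1
  rw [h2] at hs0
  rw [h3] at hs1
  obtain ⟨r1, r2, r3⟩ := phase_derivative h1 hm hn
    (s := pd 0 (pd 0 F) u) (t := pd 1 (pd 1 F) u)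
    (by linear_combination -hcomp) (by rw [h00]; ring) h11 hpos hs0 hs1
  refine ⟨hdl u hu, h1, h2, h3, ?_, ?_, ?_⟩
  · rw [hm, r1]; push_cast; ring
  · rw [hn, r2]; push_cast; ring
  · rw [r1, r2] at r3
    push_cast at r3
    linear_combination r3

/-! ### Profiles: the one-variable parts of `(X, e)` -/

/-- The solutions on `I` of the equation of the one-variable parts of `(X, e)`. -/
structure IsProfile (μ : ℂ) (I : Set ℝ) (f : ℝ → ℂ) : Prop where
  isOpen : IsOpen I
  smooth : ContDiffOn ℝ ∞ f I
  eq : ∀ x ∈ I, deriv (deriv f) x = μ - Complex.I * (deriv f x).im * deriv f x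

/-- The unit complex number `exp (-i Im f)`. -/
noncomputable def phase (f : ℝ → ℂ) (x : ℝ) : ℂ := Complex.exp (-(Complex.I * (f x).im))

/-- The planar curve `exp (-i Im f) conj f'`. -/
noncomputable def amplitude (f : ℝ → ℂ) (x : ℝ) : ℂ := phase f x * conj (deriv f x)

theorem hasDerivAt_conj {f : ℝ → ℂ} {f' : ℂ} {x : ℝ} (h : HasDerivAt f f' x) :
    HasDerivAt (fun t => conj (f t)) (conj f') x :=
  (Complex.conjCLE : ℂ →L[ℝ] ℂ).hasFDerivAt.comp_hasDerivAt x h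

theorem hasDerivAt_im {f : ℝ → ℂ} {f' : ℂ} {x : ℝ} (h : HasDerivAt f f' x) :
    HasDerivAt (fun t => (f t).im) f'.im x :=
  Complex.imCLM.hasFDerivAt.comp_hasDerivAt x h

theorem hasDerivAt_re {f : ℝ → ℂ} {f' : ℂ} {x : ℝ} (h : HasDerivAt f f' x) :
    HasDerivAt (fun t => (f t).re) f'.re x :=
  Complex.reCLM.hasFDerivAt.comp_hasDerivAt x h

theorem hasDerivAt_phase {f : ℝ → ℂ} {f' : ℂ} {x : ℝ} (h : HasDerivAt f f' x) :
    HasDerivAt (phase f) (-Complex.I * f'.im * phase f x) x := by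
  have h1 := ((((hasDerivAt_im h).ofReal_comp).const_mul Complex.I).fun_neg).cexp
  convert! h1 using 1
  simp only [phase]
  ring

theorem phase_mul_conj (f : ℝ → ℂ) (x : ℝ) : phase f x * conj (phase f x) = 1 := by
  rw [phase, ← Complex.exp_conj, ← Complex.exp_add]
  simp

theorem norm_phase (f : ℝ → ℂ) (x : ℝ) : ‖phase f x‖ = 1 := by
  rw [phase, Complex.norm_exp]
  simp

theorem eq_of_hasDerivAt_zero {f : ℝ → ℂ} {a b : ℝ}
    (h : ∀ x ∈ Set.Ioo a b, HasDerivAt f 0 x) {x y : ℝ} (hx : x ∈ Set.Ioo a b)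
    (hy : y ∈ Set.Ioo a b) : f x = f y :=
  isOpen_Ioo.is_const_of_deriv_eq_zero isPreconnected_Ioo
    (fun t ht => (h t ht).differentiableAt.differentiableWithinAt)
    (fun t ht => (h t ht).deriv) hx hy

/-! ### Restriction to coordinate lines, and separation of variables -/

section Lines

variable {V : Type*} [NormedAddCommGroup V] [NormedSpace ℝ V]

theorem hasDerivAt_fst {h : R2 → V} {x y : ℝ} (hd : DifferentiableAt ℝ h !₂[x, y]) :
    HasDerivAt (fun t : ℝ => h !₂[t, y]) (pd 0 h !₂[x, y]) x := by
  have h1 : HasDerivAt (fun t : ℝ => (!₂[t, y] : R2)) (EuclideanSpace.single 0 1) x := by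
    convert! ((hasDerivAt_id x).smul_const (EuclideanSpace.single (0 : Fin 2) (1 : ℝ))).const_add
      (!₂[0, y] : R2) using 1
    · ext t i
      fin_cases i <;> simp
    · simp
  exact hd.hasFDerivAt.comp_hasDerivAt x h1

theorem hasDerivAt_snd {h : R2 → V} {x y : ℝ} (hd : DifferentiableAt ℝ h !₂[x, y]) :
    HasDerivAt (fun t : ℝ => h !₂[x, t]) (pd 1 h !₂[x, y]) y := by
  have h1 : HasDerivAt (fun t : ℝ => (!₂[x, t] : R2)) (EuclideanSpace.single 1 1) y := by
    convert! ((hasDerivAt_id y).smul_const (EuclideanSpace.single (1 : Fin 2) (1 : ℝ))).const_add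
      (!₂[x, 0] : R2) using 1
    · ext t i
      fin_cases i <;> simp
    · simp
  exact hd.hasFDerivAt.comp_hasDerivAt y h1

end Lines

/-- The open box with sides `I`, `J`. -/
def box (I J : Set ℝ) : Set R2 := {u | u 0 ∈ I ∧ u 1 ∈ J}

theorem isOpen_box {I J : Set ℝ} (hI : IsOpen I) (hJ : IsOpen J) : IsOpen (box I J) :=
  (hI.preimage (by fun_prop : Continuous fun u : R2 => u 0)).inter
    (hJ.preimage (by fun_prop : Continuous fun u : R2 => u 1))

theorem exists_box_subset {T : Set R2} (hT : IsOpen T) {u : R2} (hu : u ∈ T) :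
    ∃ ε > 0, box (Set.Ioo (u 0 - ε) (u 0 + ε)) (Set.Ioo (u 1 - ε) (u 1 + ε)) ⊆ T := by
  obtain ⟨δ, hδ, h⟩ := Metric.isOpen_iff.mp hT u hu
  refine ⟨δ / 2, by positivity, fun v hv => h ?_⟩
  obtain ⟨⟨h1, h2⟩, h3, h4⟩ := hv
  rw [Metric.mem_ball, EuclideanSpace.dist_eq, Real.sqrt_lt' hδ, Fin.sum_univ_two, Real.dist_eq,
    Real.dist_eq, sq_abs, sq_abs]
  have a1 : (v 0 - u 0) ^ 2 < (δ / 2) ^ 2 := sq_lt_sq' (by linarith) (by linarith)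
  have a2 : (v 1 - u 1) ^ 2 < (δ / 2) ^ 2 := sq_lt_sq' (by linarith) (by linarith)
  nlinarith

theorem eq_mk (u : R2) : u = !₂[u 0, u 1] := by
  ext i; fin_cases i <;> rfl

/-- Around each point, `F` is a sum of two profiles, which determine the gradient of `ψ`. -/
theorem IsSeparatedPair.exists_profiles {T : Set R2} {F ψ : R2 → ℂ} (h : IsSeparatedPair T F ψ)
    {u₀ : R2} (hu₀ : u₀ ∈ T) :
    ∃ ε > 0, ∃ (f g : ℝ → ℂ) (μ c : ℂ),
      box (Set.Ioo (u₀ 0 - ε) (u₀ 0 + ε)) (Set.Ioo (u₀ 1 - ε) (u₀ 1 + ε)) ⊆ T ∧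
      IsProfile μ (Set.Ioo (u₀ 0 - ε) (u₀ 0 + ε)) f ∧
      IsProfile (-μ) (Set.Ioo (u₀ 1 - ε) (u₀ 1 + ε)) g ∧ ‖c‖ = 1 ∧
      ∀ x ∈ Set.Ioo (u₀ 0 - ε) (u₀ 0 + ε), ∀ y ∈ Set.Ioo (u₀ 1 - ε) (u₀ 1 + ε),
        F !₂[x, y] = f x + g y ∧
        (deriv f x ≠ 0 ∨ deriv g y ≠ 0) ∧
        HasDerivAt (fun t : ℝ => ψ !₂[t, y]) (-c * (phase f x * amplitude g y)) x ∧
        HasDerivAt (fun t : ℝ => ψ !₂[x, t]) (c * (amplitude f x * phase g y)) y := by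
  obtain ⟨l, hl⟩ := h.exists_phase
  have hT := h.isOpen
  obtain ⟨ε, hε, hbox⟩ := exists_box_subset hT hu₀
  set x₀ := u₀ 0
  set y₀ := u₀ 1
  set I := Set.Ioo (x₀ - ε) (x₀ + ε) with hI
  set J := Set.Ioo (y₀ - ε) (y₀ + ε) with hJ
  have hx₀ : x₀ ∈ I := ⟨by linarith, by linarith⟩
  have hy₀ : y₀ ∈ J := ⟨by linarith, by linarith⟩
  have mem : ∀ x ∈ I, ∀ y ∈ J, (!₂[x, y] : R2) ∈ T := fun x hx y hy => hbox ⟨hx, hy⟩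
  have dF : ∀ x ∈ I, ∀ y ∈ J, DifferentiableAt ℝ F !₂[x, y] := fun x hx y hy =>
    h.smooth_fst.differentiableAt_of_isOpen hT (mem x hx y hy)
  have dψ : ∀ x ∈ I, ∀ y ∈ J, DifferentiableAt ℝ ψ !₂[x, y] := fun x hx y hy =>
    h.smooth_snd.differentiableAt_of_isOpen hT (mem x hx y hy)
  have dpF : ∀ i, ∀ x ∈ I, ∀ y ∈ J, DifferentiableAt ℝ (pd i F) !₂[x, y] := fun i x hx y hy =>
    (contDiffOn_pd hT h.smooth_fst i).differentiableAt_of_isOpen hT (mem x hx y hy)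
  -- The value of `F` at the base point is put into `f`, so that `g` vanishes at `y₀` and `F = f +
  -- g` holds without a constant.
  obtain ⟨f, hf⟩ : ∃ f : ℝ → ℂ, ∀ x, f x = F !₂[x, y₀] := ⟨_, fun _ => rfl⟩
  obtain ⟨g, hg⟩ : ∃ g : ℝ → ℂ, ∀ y, g y = F !₂[x₀, y] - F !₂[x₀, y₀] := ⟨_, fun _ => rfl⟩
  have hfd : ∀ x ∈ I, HasDerivAt f (pd 0 F !₂[x, y₀]) x := by
    intro x hx
    rw [funext hf]
    exact hasDerivAt_fst (dF x hx y₀ hy₀)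
  have hgd : ∀ y ∈ J, HasDerivAt g (pd 1 F !₂[x₀, y]) y := by
    intro y hy
    rw [funext hg]
    exact (hasDerivAt_snd (dF x₀ hx₀ y hy)).sub_const _
  have hp : ∀ x ∈ I, ∀ y ∈ J, pd 0 F !₂[x, y] = deriv f x := by
    intro x hx y hy
    rw [(hfd x hx).deriv]
    refine eq_of_hasDerivAt_zero (f := fun y => pd 0 F !₂[x, y]) (fun t ht => ?_) hy hy₀
    rw [← h.separated _ (mem x hx t ht), pd_comm hT h.smooth_fst (mem x hx t ht)]
    exact hasDerivAt_snd (dpF 0 x hx t ht)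
  have hq : ∀ x ∈ I, ∀ y ∈ J, pd 1 F !₂[x, y] = deriv g y := by
    intro x hx y hy
    rw [(hgd y hy).deriv]
    refine eq_of_hasDerivAt_zero (f := fun x => pd 1 F !₂[x, y]) (fun t ht => ?_) hx hx₀
    rw [← h.separated _ (mem t ht y hy)]
    exact hasDerivAt_fst (dpF 1 t ht y hy)
  have hfd' : ∀ x ∈ I, HasDerivAt f (deriv f x) x := fun x hx =>
    (hfd x hx).differentiableAt.hasDerivAt
  have hgd' : ∀ x ∈ J, HasDerivAt g (deriv g x) x := fun x hx =>
    (hgd x hx).differentiableAt.hasDerivAt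
  have hF : ∀ x ∈ I, ∀ y ∈ J, F !₂[x, y] = f x + g y := by
    intro x hx y hy
    have := eq_of_hasDerivAt_zero (f := fun y => F !₂[x, y] - g y) (fun t ht => ?_) hy hy₀
    · have h0 : g y₀ = 0 := by rw [hg, sub_self]
      rw [h0, ← hf] at this
      linear_combination this
    · have := (hasDerivAt_snd (dF x hx t ht)).fun_sub (hgd' t ht)
      rwa [hq x hx t ht, sub_self] at this
  have hpp : ∀ x ∈ I, ∀ y ∈ J, pd 0 (pd 0 F) !₂[x, y] = deriv (deriv f) x := by
    intro x hx y hy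
    rw [← (hasDerivAt_fst (dpF 0 x hx y hy)).deriv]
    refine Filter.EventuallyEq.deriv_eq ?_
    filter_upwards [isOpen_Ioo.mem_nhds hx] with t ht using hp t ht y hy
  have hqq : ∀ x ∈ I, ∀ y ∈ J, pd 1 (pd 1 F) !₂[x, y] = deriv (deriv g) y := by
    intro x hx y hy
    rw [← (hasDerivAt_snd (dpF 1 x hx y hy)).deriv]
    refine Filter.EventuallyEq.deriv_eq ?_
    filter_upwards [isOpen_Ioo.mem_nhds hy] with t ht using hq x hx t ht
  have hμ : ∀ x ∈ I, ∀ y ∈ J, deriv (deriv f) x + Complex.I * (deriv f x).im * deriv f x +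
      (deriv (deriv g) y + Complex.I * (deriv g y).im * deriv g y) = 0 := by
    intro x hx y hy
    have := (hl _ (mem x hx y hy)).2.2.2.2.2.2
    rwa [hp x hx y hy, hq x hx y hy, hpp x hx y hy, hqq x hx y hy] at this
  -- Since `dl = -i l d(Im F)`, the quotient of `l` by the two phases has vanishing partial
  -- derivatives; conjugates serve as inverses of unit numbers.
  have hlc : ∀ x ∈ I, ∀ y ∈ J, l !₂[x, y] * conj (phase f x) * conj (phase g y) =
      l !₂[x₀, y₀] * conj (phase f x₀) * conj (phase g y₀) := by
    intro x hx y hy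
    trans l !₂[x₀, y] * conj (phase f x₀) * conj (phase g y)
    · refine eq_of_hasDerivAt_zero
        (f := fun x => l !₂[x, y] * conj (phase f x) * conj (phase g y)) (fun t ht => ?_) hx hx₀
      obtain ⟨h1, -, -, -, h2, -⟩ := hl _ (mem t ht y hy)
      convert! ((hasDerivAt_fst h1).fun_mul (hasDerivAt_conj (hasDerivAt_phase (hfd' t ht)))).mul_const
        (conj (phase g y)) using 1
      rw [h2, hp t ht y hy]
      simp only [map_mul, map_neg, Complex.conj_I, Complex.conj_ofReal]
      ring
    · refine eq_of_hasDerivAt_zero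
        (f := fun y => l !₂[x₀, y] * conj (phase f x₀) * conj (phase g y)) (fun t ht => ?_) hy hy₀
      obtain ⟨h1, -, -, -, -, h2, -⟩ := hl _ (mem x₀ hx₀ t ht)
      convert! ((hasDerivAt_snd h1).mul_const (conj (phase f x₀))).fun_mul
        (hasDerivAt_conj (hasDerivAt_phase (hgd' t ht))) using 1
      rw [h2, hq x₀ hx₀ t ht]
      simp only [map_mul, map_neg, Complex.conj_I, Complex.conj_ofReal]
      ring
  set c := l !₂[x₀, y₀] * conj (phase f x₀) * conj (phase g y₀) with hc
  have hlc' : ∀ x ∈ I, ∀ y ∈ J, l !₂[x, y] = c * (phase f x * phase g y) := by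
    intro x hx y hy
    rw [← hlc x hx y hy]
    linear_combination (-l !₂[x, y] * phase g y * conj (phase g y)) * phase_mul_conj f x -
      l !₂[x, y] * phase_mul_conj g y
  refine ⟨ε, hε, f, g, deriv (deriv f) x₀ + Complex.I * (deriv f x₀).im * deriv f x₀, c, hbox,
    ⟨isOpen_Ioo, ?_, fun x hx => ?_⟩, ⟨isOpen_Ioo, ?_, fun y hy => ?_⟩, ?_, ?_⟩
  · rw [funext hf]
    refine h.smooth_fst.comp (ContDiff.contDiffOn ?_) fun x hx => mem x hx y₀ hy₀
    rw [contDiff_euclidean]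
    intro i
    fin_cases i
    · exact contDiff_id
    · exact contDiff_const
  · linear_combination hμ x hx y₀ hy₀ - hμ x₀ hx₀ y₀ hy₀
  · rw [funext hg]
    refine ContDiffOn.sub (h.smooth_fst.comp (ContDiff.contDiffOn ?_) fun y hy => mem x₀ hx₀ y hy)
      contDiffOn_const
    rw [contDiff_euclidean]
    intro i
    fin_cases i
    · exact contDiff_const
    · exact contDiff_id
  · linear_combination hμ x₀ hx₀ y hy
  · have h1 : ‖l !₂[x₀, y₀]‖ = 1 := by
      have := (hl _ (mem x₀ hx₀ y₀ hy₀)).2.1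
      rw [Complex.mul_conj, Complex.normSq_eq_norm_sq] at this
      have h2 : ‖l !₂[x₀, y₀]‖ ^ 2 = 1 := by exact_mod_cast this
      exact (pow_eq_one_iff_of_nonneg (norm_nonneg _) two_ne_zero).mp h2
    simp [hc, norm_phase, h1]
  · intro x hx y hy
    obtain ⟨-, -, h2, h3, -⟩ := hl _ (mem x hx y hy)
    have h4 := h.pos _ (mem x hx y hy)
    refine ⟨hF x hx y hy, ?_, ?_, ?_⟩
    · by_contra hcon
      push Not at hcon
      rw [h2, hp x hx y hy, hq x hx y hy, hcon.1, hcon.2] at h4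
      simp at h4
    · convert! hasDerivAt_fst (dψ x hx y hy) using 1
      rw [h2, hq x hx y hy, hlc' x hx y hy, amplitude]
      ring
    · convert! hasDerivAt_snd (dψ x hx y hy) using 1
      rw [h3, hp x hx y hy, hlc' x hx y hy, amplitude]
      ring

/-- The imaginary part is the Gudermannian function, with derivative `1 / cosh`; thus the velocity
is `tanh s + i / cosh s`. -/
theorem hasDerivAt_grimReaper (s : ℝ) :
    HasDerivAt grimReaper ((Real.sinh s / Real.cosh s : ℝ) + (1 / Real.cosh s : ℝ) * Complex.I) s := by
  have hc : 0 < Real.cosh s := Real.cosh_pos s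
  have h1 : HasDerivAt (fun s => Real.log (Real.cosh s)) (Real.sinh s / Real.cosh s) s :=
    (Real.hasDerivAt_cosh s).log hc.ne'
  have h2 : HasDerivAt (fun s => 2 * Real.arctan (Real.tanh (s / 2))) (1 / Real.cosh s) s := by
    have hc2 : 0 < Real.cosh (s / 2) := Real.cosh_pos _
    have h3 : HasDerivAt (fun s => Real.tanh s) (1 / Real.cosh (s / 2) ^ 2) (s / 2) := by
      have := (Real.hasDerivAt_sinh (s / 2)).fun_div (Real.hasDerivAt_cosh (s / 2)) hc2.ne'
      simp only [← Real.tanh_eq_sinh_div_cosh] at this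
      convert! this using 1
      rw [← Real.cosh_sq_sub_sinh_sq (s / 2)]
      ring
    have h4 := (((h3.comp s ((hasDerivAt_id s).div_const 2)).arctan).const_mul 2)
    convert! h4 using 1
    have e : Real.cosh s = Real.cosh (s / 2) ^ 2 + Real.sinh (s / 2) ^ 2 := by
      rw [← Real.cosh_two_mul]; ring_nf
    have e2 : Real.cosh (s / 2) ^ 2 + Real.sinh (s / 2) ^ 2 ≠ 0 := by positivity
    rw [e]
    simp only [id_eq, Function.comp_apply, Real.tanh_eq_sinh_div_cosh]
    field_simp
  have h3 := h1.ofReal_comp.fun_add (h2.ofReal_comp.mul_const Complex.I)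
  convert! h3 using 1
  funext s
  exact (Complex.mk_eq_add_mul_I _ _)

/-! ### Amplitudes of profiles and their rescaling -/

namespace IsProfile

variable {μ : ℂ} {I : Set ℝ} {f : ℝ → ℂ}

theorem contDiffOn_deriv (h : IsProfile μ I f) : ContDiffOn ℝ ∞ (deriv f) I :=
  h.smooth.deriv_of_isOpen h.isOpen (by simp)

theorem hasDerivAt (h : IsProfile μ I f) {x : ℝ} (hx : x ∈ I) : HasDerivAt f (deriv f x) x :=
  ((h.smooth.contDiffAt (h.isOpen.mem_nhds hx)).differentiableAt (by simp)).hasDerivAt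

theorem hasDerivAt_deriv (h : IsProfile μ I f) {x : ℝ} (hx : x ∈ I) :
    HasDerivAt (deriv f) (μ - Complex.I * (deriv f x).im * deriv f x) x := by
  rw [← h.eq x hx]
  exact ((h.contDiffOn_deriv.contDiffAt (h.isOpen.mem_nhds hx)).differentiableAt
    (by simp)).hasDerivAt

/-- The derivative of the phase cancels the quadratic term of the equation for `f''`, and only the
constant `conj μ` survives. -/
theorem hasDerivAt_amplitude (h : IsProfile μ I f) {x : ℝ} (hx : x ∈ I) :
    HasDerivAt (amplitude f) (conj μ * phase f x) x := by
  have h1 := (hasDerivAt_phase (h.hasDerivAt hx)).fun_mul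
    (hasDerivAt_conj (h.hasDerivAt_deriv hx))
  convert! h1 using 1
  simp only [map_sub, map_mul, Complex.conj_I, Complex.conj_ofReal]
  ring

theorem contDiffOn_phase (h : IsProfile μ I f) : ContDiffOn ℝ ∞ (phase f) I := by
  have h1 : ContDiffOn ℝ ∞ (fun x => ((f x).im : ℂ)) I :=
    (Complex.ofRealCLM.comp Complex.imCLM).contDiff.comp_contDiffOn h.smooth
  exact (contDiffOn_const.mul h1).neg.cexp

theorem contDiffOn_amplitude (h : IsProfile μ I f) : ContDiffOn ℝ ∞ (amplitude f) I :=
  h.contDiffOn_phase.mul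
    ((Complex.conjCLE : ℂ →L[ℝ] ℂ).contDiff.comp_contDiffOn h.contDiffOn_deriv)

theorem deriv_comp_div (h : IsProfile μ I f) (r : ℝ) {t : ℝ} (ht : t / r ∈ I) :
    deriv (fun t => f (t / r)) t = deriv f (t / r) / r := by
  have h2 := (h.hasDerivAt ht).scomp t ((hasDerivAt_id t).div_const r)
  rw [show (fun t => f (t / r)) = f ∘ fun t => id t / r from rfl, h2.deriv, Complex.real_smul]
  push_cast
  ring

/-- Both `f''` and `(Im f') f'` scale by `1 / r ^ 2`, so dilating the parameter normalizes `|μ|`. -/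
theorem comp_div (h : IsProfile μ I f) {r : ℝ} (hr : r ≠ 0) :
    IsProfile (μ / r ^ 2) {t | t / r ∈ I} (fun t => f (t / r)) := by
  have ho : IsOpen {t | t / r ∈ I} := h.isOpen.preimage (by fun_prop : Continuous fun t => t / r)
  refine ⟨ho, h.smooth.comp (by fun_prop) fun t ht => ht, fun t ht => ?_⟩
  have h1 : deriv (fun t => f (t / r)) =ᶠ[nhds t] fun t => deriv f (t / r) / r := by
    filter_upwards [ho.mem_nhds ht] with s hs using h.deriv_comp_div r hs
  have h2 := ((h.hasDerivAt_deriv ht).scomp t ((hasDerivAt_id t).div_const r)).div_const (r : ℂ)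
  have h3 : deriv (fun t => deriv f (t / r) / (r : ℂ)) t = _ := h2.deriv
  rw [h1.deriv_eq, h3, h.deriv_comp_div r ht, Complex.real_smul]
  have hrc : (r : ℂ) ≠ 0 := by exact_mod_cast hr
  rw [show (deriv f (t / r) / (r : ℂ)).im = (deriv f (t / r)).im / r from Complex.div_ofReal_im ..]
  push_cast
  field_simp

theorem amplitude_comp_div (h : IsProfile μ I f) (r : ℝ) {t : ℝ} (ht : t / r ∈ I) :
    amplitude (fun t => f (t / r)) t = amplitude f (t / r) / r := by
  rw [amplitude, h.deriv_comp_div r ht, amplitude, map_div₀, Complex.conj_ofReal]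
  simp only [phase]
  ring

/-! #### Soliton curves -/

section SolitonCurve

variable {ϕ : ℝ}

theorem deriv_amplitude (h : IsProfile (-Complex.exp (ϕ * Complex.I)) I f) {x : ℝ} (hx : x ∈ I) :
    deriv (amplitude f) x =
      Complex.exp ((-(f x).im + Real.pi - ϕ : ℝ) * Complex.I) := by
  rw [(h.hasDerivAt_amplitude hx).deriv, phase]
  have h1 : conj (-Complex.exp (ϕ * Complex.I)) = Complex.exp ((Real.pi - ϕ : ℝ) * Complex.I) := by
    rw [map_neg, ← Complex.exp_conj]
    push_cast
    rw [sub_mul, Complex.exp_sub, Complex.exp_pi_mul_I]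
    simp [Complex.exp_neg, div_eq_mul_inv]
  rw [h1, ← Complex.exp_add]
  push_cast
  ring_nf

theorem deriv_eq_amplitude (h : IsProfile (-Complex.exp (ϕ * Complex.I)) I f) {x : ℝ} (hx : x ∈ I) :
    deriv f x = -Complex.exp (ϕ * Complex.I) * (conj (amplitude f x) * deriv (amplitude f) x) := by
  have h0 : Complex.exp (ϕ * Complex.I) * conj (Complex.exp (ϕ * Complex.I)) = 1 := by
    rw [← Complex.exp_conj, ← Complex.exp_add]; simp
  rw [(h.hasDerivAt_amplitude hx).deriv, amplitude]
  simp only [map_mul, map_neg, Complex.conj_conj]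
  linear_combination -deriv f x * phase_mul_conj f x -
    deriv f x * phase f x * conj (phase f x) * h0

theorem re_deriv (h : IsProfile (-Complex.exp (ϕ * Complex.I)) I f) {x : ℝ} (hx : x ∈ I) :
    (deriv f x).re = -Real.cos ϕ * (conj (amplitude f x) * deriv (amplitude f) x).re +
      Real.sin ϕ * (conj (amplitude f x) * deriv (amplitude f) x).im := by
  rw [h.deriv_eq_amplitude hx]
  generalize conj (amplitude f x) * deriv (amplitude f) x = A
  rw [Complex.mul_re, Complex.neg_re, Complex.neg_im,
    Complex.exp_ofReal_mul_I_re, Complex.exp_ofReal_mul_I_im]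
  ring

theorem im_deriv (h : IsProfile (-Complex.exp (ϕ * Complex.I)) I f) {x : ℝ} (hx : x ∈ I) :
    (deriv f x).im = -(Real.sin ϕ * (conj (amplitude f x) * deriv (amplitude f) x).re +
      Real.cos ϕ * (conj (amplitude f x) * deriv (amplitude f) x).im) := by
  rw [h.deriv_eq_amplitude hx]
  generalize conj (amplitude f x) * deriv (amplitude f) x = A
  rw [Complex.mul_im, Complex.neg_re, Complex.neg_im,
    Complex.exp_ofReal_mul_I_re, Complex.exp_ofReal_mul_I_im]
  ring

/-- Here `μ` is unimodular, so the amplitude has unit speed with tangent angle `-Im f + π - ϕ`, and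
its signed curvature is `-Im f'`. Inverting the definition of the amplitude expresses `f'` by `conj
A * A'`, which turns this curvature into the prescribed combination of normal components. -/
theorem isSolitonCurve (h : IsProfile (-Complex.exp (ϕ * Complex.I)) I f)
    (hI : I.OrdConnected) :
    IsSolitonCurve (-Real.cos ϕ) (Real.sin ϕ) I (amplitude f)
      (fun t => -(f t).im + Real.pi - ϕ) := by
  refine ⟨h.isOpen, hI, h.contDiffOn_amplitude, fun t ht => ?_, fun t ht => ?_, ?_,
    fun t ht => h.deriv_amplitude ht⟩
  · rw [h.deriv_amplitude ht, Complex.norm_exp_ofReal_mul_I]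
  · have h1 : deriv (amplitude f) =ᶠ[nhds t]
        fun t => conj (-Complex.exp (ϕ * Complex.I)) * phase f t := by
      filter_upwards [h.isOpen.mem_nhds ht] with s hs using (h.hasDerivAt_amplitude hs).deriv
    have h2 : deriv (deriv (amplitude f)) t =
        -Complex.I * (deriv f t).im * deriv (amplitude f) t := by
      rw [h1.deriv_eq, ((hasDerivAt_phase (h.hasDerivAt ht)).const_mul _).deriv,
        (h.hasDerivAt_amplitude ht).deriv]
      ring
    have h4 := h.im_deriv ht
    have hu : deriv (amplitude f) t * conj (deriv (amplitude f) t) = 1 := by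
      rw [Complex.mul_conj, Complex.normSq_eq_norm_sq, h.deriv_amplitude ht,
        Complex.norm_exp_ofReal_mul_I]
      simp
    rw [h2]
    set a' := deriv (amplitude f) t
    set a := amplitude f t
    have h5 : ∀ v : ℂ, normalComp a' v = Complex.I * (v * conj a').im * a' := by
      intro v
      have : ((v * conj a').re : ℂ) + (v * conj a').im * Complex.I = v * conj a' :=
        Complex.re_add_im _
      rw [normalComp, dot, Complex.real_smul]
      linear_combination (-v) * hu - a' * this
    have h6 : (conj a * a').im = -(a * conj a').im := by simp; ring
    have h7 : (conj a * a').re = (Complex.I * a * conj a').im := by simp; ring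
    rw [h5, h5, h4, h6, h7, Complex.real_smul, Complex.real_smul]
    push_cast
    ring
  · have : ContinuousOn f I := h.smooth.continuousOn
    fun_prop

theorem hasDerivAt_re_profile (h : IsProfile (-Complex.exp (ϕ * Complex.I)) I f) {x : ℝ}
    (hx : x ∈ I) :
    HasDerivAt (fun t => (f t).re)
      (-Real.cos ϕ * (conj (amplitude f x) * deriv (amplitude f) x).re +
        Real.sin ϕ * (conj (amplitude f x) * deriv (amplitude f) x).im) x := by
  convert! hasDerivAt_re (h.hasDerivAt hx) using 1
  rw [h.re_deriv hx]

/-- For `cos ϕ ≠ 0`, the real part of a profile in terms of its amplitude. -/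
theorem exists_re_eq {a b : ℝ} (h : IsProfile (-Complex.exp (ϕ * Complex.I)) (Set.Ioo a b) f)
    (hϕ : Real.cos ϕ ≠ 0) :
    ∃ k : ℝ, ∀ x ∈ Set.Ioo a b, (f x).re =
      -‖amplitude f x‖ ^ 2 / (2 * Real.cos ϕ) + Real.tan ϕ * (-(f x).im + Real.pi - ϕ) + k := by
  rcases (Set.Ioo a b).eq_empty_or_nonempty with he | ⟨x₀, hx₀⟩
  · exact ⟨0, by simp [he]⟩
  -- With `conj A * A' = a + i b`, one has `Re f' = -cos ϕ · a + sin ϕ · b` and `Im f' = -(sin ϕ · a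
  -- + cos ϕ · b)`. Eliminating `b` gives `Re f' = -a / cos ϕ - tan ϕ · Im f'`, and `2 a` is the
  -- derivative of `|A|²`.
  have hd : ∀ x ∈ Set.Ioo a b, HasDerivAt (fun x => (f x).re -
      (-‖amplitude f x‖ ^ 2 / (2 * Real.cos ϕ) + Real.tan ϕ * (-(f x).im + Real.pi - ϕ))) 0 x := by
    intro x hx
    have h1 := (h.hasDerivAt_amplitude hx).differentiableAt.hasDerivAt
    have h2 : HasDerivAt (fun x => ‖amplitude f x‖ ^ 2)
        (2 * (conj (amplitude f x) * deriv (amplitude f) x).re) x := by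
      have := h1.norm_sq
      convert! this using 2
      rw [Complex.inner, mul_comm]
    have h3 := (h.hasDerivAt_re_profile hx).fun_sub ((h2.fun_neg.div_const (2 * Real.cos ϕ)).fun_add
      ((((hasDerivAt_im (h.hasDerivAt hx)).fun_neg.add_const Real.pi).sub_const ϕ).const_mul
        (Real.tan ϕ)))
    convert! h3 using 1
    rw [h.im_deriv hx, Real.tan_eq_sin_div_cos]
    field_simp
    have := Real.sin_sq_add_cos_sq ϕ
    linear_combination (conj (amplitude f x) * deriv (amplitude f) x).re * this
  refine ⟨(f x₀).re -
      (-‖amplitude f x₀‖ ^ 2 / (2 * Real.cos ϕ) + Real.tan ϕ * (-(f x₀).im + Real.pi - ϕ)),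
    fun x hx => ?_⟩
  have := eq_of_hasDerivAt_zero (fun t ht => (hd t ht).ofReal_comp) hx hx₀
  have h2 := Complex.ofReal_injective this
  linarith

/-- For `cos ϕ = 0`, the real part of a profile in terms of its amplitude. -/
theorem exists_re_eq_integral {a b x₀ : ℝ}
    (h : IsProfile (-Complex.exp (ϕ * Complex.I)) (Set.Ioo a b) f)
    (hϕ : Real.cos ϕ = 0) (hx₀ : x₀ ∈ Set.Ioo a b) :
    ∃ k : ℝ, ∀ x ∈ Set.Ioo a b, (f x).re =
      Real.sin ϕ * (∫ t in x₀..x, dot (deriv (amplitude f) t) (Complex.I * amplitude f t)) + k := by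
  have hdot : ∀ x, dot (deriv (amplitude f) x) (Complex.I * amplitude f x) =
      (conj (amplitude f x) * deriv (amplitude f) x).im := by
    intro x; simp [dot]; ring
  have hcont : ContinuousOn
      (fun t => dot (deriv (amplitude f) t) (Complex.I * amplitude f t)) (Set.Ioo a b) := by
    have h1 : ContinuousOn (amplitude f) (Set.Ioo a b) := h.contDiffOn_amplitude.continuousOn
    have h2 : ContinuousOn (deriv (amplitude f)) (Set.Ioo a b) :=
      h.contDiffOn_amplitude.continuousOn_deriv_of_isOpen h.isOpen (by simp)
    simp only [hdot]
    exact Complex.continuous_im.comp_continuousOn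
      ((Complex.continuous_conj.comp_continuousOn h1).mul h2)
  refine ⟨(f x₀).re, fun x hx => ?_⟩
  have hsub : Set.uIcc x₀ x ⊆ Set.Ioo a b := Set.ordConnected_Ioo.uIcc_subset hx₀ hx
  rw [← intervalIntegral.integral_const_mul, intervalIntegral.integral_eq_sub_of_hasDerivAt
    (f := fun t => (f t).re)]
  · ring
  · intro t ht
    convert! h.hasDerivAt_re_profile (hsub ht) using 1
    rw [hϕ, hdot]; ring
  · exact ((continuousOn_const.mul hcont).mono hsub).intervalIntegrable

end SolitonCurve

/-! #### Grim reapers -/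

/-- A first integral for `μ = 0`: it forces `Im f'` to vanish everywhere or nowhere on the interval.
-/
theorem im_deriv_mul_exp {a b : ℝ} (h : IsProfile 0 (Set.Ioo a b) f) {x y : ℝ}
    (hx : x ∈ Set.Ioo a b) (hy : y ∈ Set.Ioo a b) :
    (deriv f x).im * Real.exp (f x).re = (deriv f y).im * Real.exp (f y).re := by
  apply Complex.ofReal_injective
  refine eq_of_hasDerivAt_zero
    (f := fun x => (((deriv f x).im * Real.exp (f x).re : ℝ) : ℂ)) (fun t ht => ?_) hx hy
  have h1 := ((hasDerivAt_im (h.hasDerivAt_deriv ht)).fun_mul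
    (hasDerivAt_re (h.hasDerivAt ht)).exp).ofReal_comp
  convert! h1 using 1
  rw [← Complex.ofReal_zero]
  congr 1
  simp
  ring

/-- A profile with `μ = 0` is affine or a grim reaper. -/
theorem eq_grimReaper {a b : ℝ} (h : IsProfile 0 (Set.Ioo a b) f) :
    (∀ x ∈ Set.Ioo a b, HasDerivAt (phase f) 0 x) ∨
    ∃ (κ c : ℝ) (d : ℂ), κ ≠ 0 ∧ (∀ x ∈ Set.Ioo a b, f x = grimReaper (κ * x + c) + d ∧
      ‖deriv f x‖ = |κ|) := by
  by_cases h0 : ∀ x ∈ Set.Ioo a b, (deriv f x).im = 0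
  · left
    intro x hx
    convert! hasDerivAt_phase (h.hasDerivAt hx) using 1
    simp [h0 x hx]
  right
  push Not at h0
  obtain ⟨x₀, hx₀, h0⟩ := h0
  have him : ∀ x ∈ Set.Ioo a b, (deriv f x).im ≠ 0 := by
    intro x hx h1
    have := h.im_deriv_mul_exp hx hx₀
    rw [h1, zero_mul] at this
    exact mul_ne_zero h0 (Real.exp_pos _).ne' this.symm
  -- On a grim reaper `Re f' / Im f' = sinh s` for the arc length parameter `s`; this recovers `s`
  -- up to an affine change, with `s' = Im f' · cosh s` constant and possibly negative.
  obtain ⟨s, hs⟩ : ∃ s : ℝ → ℝ, ∀ x, s x = Real.arsinh ((deriv f x).re / (deriv f x).im) :=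
    ⟨_, fun _ => rfl⟩
  have hsinh : ∀ x, Real.sinh (s x) = (deriv f x).re / (deriv f x).im := by
    intro x; rw [hs, Real.sinh_arsinh]
  have hre : ∀ x ∈ Set.Ioo a b, HasDerivAt (fun t => (deriv f t).re) ((deriv f x).im ^ 2) x := by
    intro x hx
    convert! hasDerivAt_re (h.hasDerivAt_deriv hx) using 1
    simp
    ring
  have him' : ∀ x ∈ Set.Ioo a b, HasDerivAt (fun t => (deriv f t).im)
      (-(deriv f x).im * (deriv f x).re) x := by
    intro x hx
    convert! hasDerivAt_im (h.hasDerivAt_deriv hx) using 1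
    simp
  have hsd : ∀ x ∈ Set.Ioo a b, HasDerivAt s ((deriv f x).im * Real.cosh (s x)) x := by
    intro x hx
    have h1 := ((hre x hx).fun_div (him' x hx) (him x hx)).arsinh
    have hc := Real.cosh_sq' (s x)
    rw [hsinh] at hc
    rw [← funext hs, ← hc, Real.sqrt_sq (Real.cosh_pos _).le] at h1
    convert! h1 using 1
    have hcp := (Real.cosh_pos (s x)).ne'
    have hi := him x hx
    rw [smul_eq_mul]
    field_simp at hc ⊢
    linear_combination hc
  obtain ⟨κ, hκ⟩ : ∃ κ, ∀ x ∈ Set.Ioo a b, (deriv f x).im * Real.cosh (s x) = κ := by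
    refine ⟨(deriv f x₀).im * Real.cosh (s x₀), fun x hx => Complex.ofReal_injective ?_⟩
    refine eq_of_hasDerivAt_zero
      (f := fun x => (((deriv f x).im * Real.cosh (s x) : ℝ) : ℂ)) (fun t ht => ?_) hx hx₀
    convert! ((him' t ht).fun_mul (hsd t ht).cosh).ofReal_comp using 1
    rw [← Complex.ofReal_zero, hsinh]
    congr 1
    have hi := him t ht
    field_simp
    ring
  obtain ⟨c, hc⟩ : ∃ c, ∀ x ∈ Set.Ioo a b, s x = κ * x + c := by
    refine ⟨s x₀ - κ * x₀, fun x hx => ?_⟩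
    have := eq_of_hasDerivAt_zero (f := fun x => ((s x - κ * x : ℝ) : ℂ)) (fun t ht => ?_) hx hx₀
    · have := Complex.ofReal_injective this
      linarith
    · convert! ((hsd t ht).fun_sub ((hasDerivAt_id t).const_mul κ)).ofReal_comp using 1
      rw [hκ t ht]
      simp
  have hκ2 : ∀ x ∈ Set.Ioo a b, Complex.normSq (deriv f x) = κ ^ 2 := by
    intro x hx
    have h1 := Real.cosh_sq' (s x)
    have hi := him x hx
    rw [hsinh] at h1
    rw [← hκ x hx, mul_pow, h1, Complex.normSq_apply]
    field_simp
    ring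
  refine ⟨κ, c, f x₀ - grimReaper (κ * x₀ + c), ?_, fun x hx => ⟨?_, ?_⟩⟩
  · rw [← hκ x₀ hx₀]
    exact mul_ne_zero (him x₀ hx₀) (Real.cosh_pos _).ne'
  · have := eq_of_hasDerivAt_zero (f := fun x => f x - grimReaper (κ * x + c))
      (fun t ht => ?_) hx hx₀
    · linear_combination this
    · have hl : HasDerivAt (fun t => κ * t + c) κ t := by
        simpa using ((hasDerivAt_id t).const_mul κ).add_const c
      convert! (h.hasDerivAt ht).fun_sub ((hasDerivAt_grimReaper (κ * t + c)).scomp t hl) using 1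
      rw [← hc t ht, hsinh, ← hκ t ht]
      have hcp := (Real.cosh_pos (s t)).ne'
      have hi := him t ht
      have e : deriv f t = ((deriv f t).re : ℂ) + (deriv f t).im * Complex.I :=
        (Complex.re_add_im _).symm
      generalize (deriv f t).re = C at *
      generalize (deriv f t).im = S at *
      rw [e, Complex.real_smul]
      have hcp' : (Real.cosh (s t) : ℂ) ≠ 0 := by exact_mod_cast hcp
      have hi' : (S : ℂ) ≠ 0 := by exact_mod_cast hi
      push_cast at hcp' ⊢
      field_simp
      ring
  · rw [← abs_norm, ← sq_eq_sq_iff_abs_eq_abs, ← Complex.normSq_eq_norm_sq, hκ2 x hx]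

end IsProfile

/-! ### Affine changes of coordinates and the maps `α ∗ w` -/

theorem contDiffOn_R2 {S : Set R2} {G : R2 → R2} (h : ∀ i, ContDiffOn ℝ ∞ (fun u => G u i) S) :
    ContDiffOn ℝ ∞ G S :=
  contDiffOn_euclidean.mpr h

theorem contDiff_coord (i : Fin 2) : ContDiff ℝ ∞ (fun u : R2 => u i) := by fun_prop

/-- Congruence by a change of coordinates that rescales and shifts each coordinate and possibly
exchanges them. -/
theorem locallyCongruentAt_of_affine [IsManifold (𝓡 2) ∞ M] {φ : M → C2}
    {z : OpenPartialHomeomorph M R2} (hz : z ∈ IsManifold.maximalAtlas (𝓡 2) ∞ M)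
    {p : M} (hp : p ∈ z.source) {D S : Set R2} {E : R2 → C2}
    (hS : IsOpen S) (hpS : z p ∈ S) (hD : IsOpen D) (σ : Equiv.Perm (Fin 2))
    {k c : Fin 2 → ℝ} (hk : ∀ i, k i ≠ 0) {r : ℝ} (hr : 0 < r) (U : C2 ≃ₗᵢ[ℂ] C2) (b : C2)
    (h : ∀ u ∈ S, (WithLp.toLp 2 fun i => k i * u (σ i) + c i : R2) ∈ D ∧
      φ (z.symm u) = r • U (E (WithLp.toLp 2 fun i => k i * u (σ i) + c i)) + b) :
    LocallyCongruentAt φ p D E := by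
  refine locallyCongruentAt_of_coordinate hz hp (E := E)
    (G := fun u => WithLp.toLp 2 fun i => k i * u (σ i) + c i)
    (K := fun v => WithLp.toLp 2 fun i => (v (σ.symm i) - c (σ.symm i)) / k (σ.symm i))
    hS hpS hD subset_rfl ?_ ?_ (fun u hu => (h u hu).1) ?_ ?_ r hr U b fun u hu => (h u hu).2
  · refine contDiffOn_R2 fun i => ContDiff.contDiffOn ?_
    exact (contDiff_const.mul (contDiff_coord _)).add contDiff_const
  · refine contDiffOn_R2 fun i => ContDiff.contDiffOn ?_
    exact ((contDiff_coord _).sub contDiff_const).div_const _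
  · intro u _
    ext i
    simp [hk]
  · intro v _ _
    ext i
    simp
    field_simp [hk i]
    ring

/-- The map `α ∗ w` built from the amplitudes of two profiles. -/
theorem exists_starMap_eq {ϕ a b a' b' : ℝ} {f g : ℝ → ℂ}
    (hf : IsProfile (-Complex.exp (ϕ * Complex.I)) (Set.Ioo a b) f)
    (hg : IsProfile (Complex.exp (ϕ * Complex.I)) (Set.Ioo a' b') g) (hϕ : ϕ ∈ Set.Ico 0 Real.pi)
    {t₀ s₀ : ℝ} (ht₀ : t₀ ∈ Set.Ioo a b) (hs₀ : s₀ ∈ Set.Ioo a' b') :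
    ∃ ξ ϑ : ℝ → ℝ,
      IsSolitonCurve (-Real.cos ϕ) (Real.sin ϕ) (Set.Ioo a b) (amplitude f) ξ ∧
      IsSolitonCurve (Real.cos ϕ) (-Real.sin ϕ) (Set.Ioo a' b') (amplitude g) ϑ ∧
      ∃ d : ℂ, ∀ u : R2, u 0 ∈ Set.Ioo a b → u 1 ∈ Set.Ioo a' b' →
        starMap ϕ (amplitude f) (amplitude g) ξ ϑ t₀ s₀ u =
          !₂[f (u 0) + g (u 1) + d, amplitude f (u 0) * amplitude g (u 1)] := by
  -- Replacing `ϕ` by `ϕ + π` flips the signs of cosine and sine, so the second curve comes from the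
  -- lemmas for the first.
  have hexp : Complex.exp (ϕ * Complex.I) = -Complex.exp ((ϕ + Real.pi : ℝ) * Complex.I) := by
    push_cast
    rw [add_mul, Complex.exp_add, Complex.exp_pi_mul_I]
    ring
  rw [hexp] at hg
  have hc2 : Real.cos (ϕ + Real.pi) = -Real.cos ϕ := Real.cos_add_pi ϕ
  have hs2 : Real.sin (ϕ + Real.pi) = -Real.sin ϕ := Real.sin_add_pi ϕ
  have hsc := hg.isSolitonCurve Set.ordConnected_Ioo
  rw [hc2, hs2, neg_neg] at hsc
  refine ⟨_, _, hf.isSolitonCurve Set.ordConnected_Ioo, hsc, ?_⟩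
  by_cases hcase : ϕ = Real.pi / 2
  · have hcos : Real.cos ϕ = 0 := by rw [hcase, Real.cos_pi_div_two]
    have hsin : Real.sin ϕ = 1 := by rw [hcase, Real.sin_pi_div_two]
    obtain ⟨k, hk⟩ := hf.exists_re_eq_integral hcos ht₀
    obtain ⟨l, hl⟩ := hg.exists_re_eq_integral (by rw [hc2, hcos, neg_zero]) hs₀
    -- The two angles are `-Im f + π - ϕ` and, with `ϕ + π` for `ϕ`, `-Im g - ϕ`; the imaginary part
    -- of the constant compensates for their sum `-Im (f + g) + π - 2ϕ`.
    refine ⟨⟨-k - l, 2 * ϕ - Real.pi⟩, fun u hu0 hu1 => ?_⟩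
    have h1 := hk _ hu0
    have h2 := hl _ hu1
    rw [hsin, one_mul] at h1
    rw [hs2, hsin] at h2
    rw [starMap, if_pos hcase]
    congr 2
    apply Complex.ext
    · simp only [Complex.sub_re, Complex.add_re, Complex.ofReal_re, Complex.mul_re, Complex.I_re,
        Complex.I_im, Complex.ofReal_im]
      linarith
    · simp only [Complex.sub_im, Complex.add_im, Complex.ofReal_re, Complex.mul_im, Complex.I_re,
        Complex.I_im, Complex.ofReal_im]
      ring
  · have hcos : Real.cos ϕ ≠ 0 := by
      intro h0
      apply hcase
      refine Real.injOn_cos ⟨hϕ.1, hϕ.2.le⟩ ⟨by positivity, by linarith [Real.pi_pos]⟩ ?_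
      rw [h0, Real.cos_pi_div_two]
    obtain ⟨k, hk⟩ := hf.exists_re_eq hcos
    obtain ⟨l, hl⟩ := hg.exists_re_eq (by rw [hc2]; exact neg_ne_zero.mpr hcos)
    refine ⟨⟨-k - l, 2 * ϕ - Real.pi⟩, fun u hu0 hu1 => ?_⟩
    have h1 := hk _ hu0
    have h2 := hl _ hu1
    rw [hc2, Real.tan_add_pi] at h2
    rw [starMap, if_neg hcase]
    congr 2
    apply Complex.ext
    · simp only [Complex.sub_re, Complex.add_re, Complex.ofReal_re, Complex.mul_re, Complex.I_re,
        Complex.I_im, Complex.ofReal_im, Complex.sub_im, h1, h2]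
      field_simp
      ring
    · simp only [Complex.sub_im, Complex.add_im, Complex.ofReal_re, Complex.mul_im, Complex.I_re,
        Complex.I_im, Complex.ofReal_im, Complex.sub_re]
      ring

/-- The conclusion of the classification in the case of the maps `α ∗ w`. -/
def IsLocallyStar (φ : M → C2) (p : M) : Prop :=
  ∃ ϕ ∈ Set.Ico (0 : ℝ) Real.pi,
    ∃ (I₁ I₂ : Set ℝ) (α w : ℝ → ℂ) (ξ ϑ : ℝ → ℝ) (t₀ s₀ : ℝ),
      IsSolitonCurve (-Real.cos ϕ) (Real.sin ϕ) I₁ α ξ ∧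
      IsSolitonCurve (Real.cos ϕ) (-Real.sin ϕ) I₂ w ϑ ∧
      t₀ ∈ I₁ ∧ s₀ ∈ I₂ ∧
      LocallyCongruentAt φ p {u | u 0 ∈ I₁ ∧ u 1 ∈ I₂} (starMap ϕ α w ξ ϑ t₀ s₀)

theorem isLocallyStar_of_profiles [IsManifold (𝓡 2) ∞ M] {φ : M → C2}
    {z : OpenPartialHomeomorph M R2} (hz : z ∈ IsManifold.maximalAtlas (𝓡 2) ∞ M)
    {p : M} (hp : p ∈ z.source) {S : Set R2} (hS : IsOpen S) (hpS : z p ∈ S)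
    (σ : Equiv.Perm (Fin 2)) {ϕ ρ a b a' b' : ℝ} (hϕ : ϕ ∈ Set.Ico 0 Real.pi) (hρ : 0 < ρ)
    {f g : ℝ → ℂ} (hf : IsProfile (-(ρ ^ 2 * Complex.exp (ϕ * Complex.I))) (Set.Ioo a b) f)
    (hg : IsProfile (ρ ^ 2 * Complex.exp (ϕ * Complex.I)) (Set.Ioo a' b') g)
    {v w B : C2} (hv : ‖v‖ = 1) (hw : ‖w‖ = 1) (hvw : inner ℂ v w = 0) {r : ℝ} (hr : 0 < r)
    (h : ∀ u ∈ S, u (σ 0) ∈ Set.Ioo a b ∧ u (σ 1) ∈ Set.Ioo a' b' ∧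
      φ (z.symm u) = r • ((f (u (σ 0)) + g (u (σ 1))) • v +
        (amplitude f (u (σ 0)) * amplitude g (u (σ 1)) / ρ ^ 2) • w) + B) :
    IsLocallyStar φ p := by
  have hρ' : (ρ : ℂ) ≠ 0 := by exact_mod_cast hρ.ne'
  have hset : ∀ a b : ℝ, {t | t / ρ ∈ Set.Ioo a b} = Set.Ioo (a * ρ) (b * ρ) := by
    intro a b
    ext t
    simp [lt_div_iff₀ hρ, div_lt_iff₀ hρ]
  have hf1 := hf.comp_div hρ.ne'
  have hg1 := hg.comp_div hρ.ne'
  rw [hset, neg_div, mul_div_cancel_left₀ _ (pow_ne_zero 2 hρ')] at hf1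
  rw [hset, mul_div_cancel_left₀ _ (pow_ne_zero 2 hρ')] at hg1
  have hmem : ∀ x a b : ℝ, x ∈ Set.Ioo a b → ρ * x ∈ Set.Ioo (a * ρ) (b * ρ) := by
    intro x a b hx
    constructor <;> nlinarith [hx.1, hx.2]
  obtain ⟨h1, h2, -⟩ := h _ hpS
  have ht₀ := hmem _ _ _ h1
  have hs₀ := hmem _ _ _ h2
  obtain ⟨ξ, ϑ, hα, hw', d, hd⟩ := exists_starMap_eq hf1 hg1 hϕ ht₀ hs₀
  obtain ⟨U, hU⟩ := exists_unitary hv hw hvw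
  refine ⟨ϕ, hϕ, _, _, _, _, ξ, ϑ, _, _, hα, hw', ht₀, hs₀,
    locallyCongruentAt_of_affine hz hp hS hpS (isOpen_box isOpen_Ioo isOpen_Ioo) σ
      (k := fun _ => ρ) (c := fun _ => 0) (fun _ => hρ.ne') hr U (B - r • d • v) fun u hu => ?_⟩
  obtain ⟨hu0, hu1, hu⟩ := h u hu
  have m0 := hmem _ _ _ hu0
  have m1 := hmem _ _ _ hu1
  refine ⟨⟨by simpa using m0, by simpa using m1⟩, ?_⟩
  have e : ∀ x : ℝ, ρ * x / ρ = x := fun x => by field_simp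
  rw [hd _ (by simpa using m0) (by simpa using m1), hU, hu]
  simp only [add_zero]
  rw [hf.amplitude_comp_div ρ (by rw [e]; exact hu0), hg.amplitude_comp_div ρ (by rw [e]; exact hu1),
    e, e, div_mul_div_comm, ← sq, add_smul (f (u (σ 0)) + g (u (σ 1))) d v]
  module

/-! ### Primitives of the phase when `μ = 0` -/

theorem deriv_eq_conj_amplitude (f : ℝ → ℂ) (x : ℝ) :
    deriv f x = conj (amplitude f x) * phase f x := by
  rw [amplitude, map_mul, Complex.conj_conj]
  linear_combination (-deriv f x) * phase_mul_conj f x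

/-- A profile with `μ = 0` and constant amplitude `P`: the primitive of its phase. -/
theorem IsProfile.exists_primitive {a b : ℝ} {f : ℝ → ℂ} {P : ℂ} {x₀ : ℝ} (hx₀ : x₀ ∈ Set.Ioo a b)
    (h : IsProfile 0 (Set.Ioo a b) f) (hP : ∀ x ∈ Set.Ioo a b, amplitude f x = P) :
    ∃ h : ℝ → ℂ, (∀ x ∈ Set.Ioo a b, HasDerivAt h (phase f x) x) ∧
      ((∃ w : ℂ, ‖w‖ = 1 ∧ ∀ x : ℝ, h x = x * w) ∨
        ∃ (κ c : ℝ) (d w : ℂ), κ ≠ 0 ∧ ‖w‖ = 1 ∧ ∀ x ∈ Set.Ioo a b,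
          h x = (|κ|⁻¹ : ℝ) * grimReaper (κ * x + c) * w + d) := by
  have hd : ∀ x ∈ Set.Ioo a b, deriv f x = conj P * phase f x := fun x hx =>
    hP x hx ▸ deriv_eq_conj_amplitude f x
  rcases h.eq_grimReaper with h0 | ⟨κ, c, d, hκ, hf⟩
  -- A constant phase is integrated directly rather than by dividing `f` by `conj P`, because `P =
  -- 0` is possible here.
  · refine ⟨fun x => x * phase f x₀, fun x hx => ?_, Or.inl ⟨phase f x₀, norm_phase f x₀,
      fun x => rfl⟩⟩
    rw [eq_of_hasDerivAt_zero h0 hx hx₀]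
    simpa using (Complex.ofRealCLM.hasDerivAt (x := x)).mul_const (phase f x₀)
  · have hnP : ‖conj P‖ = |κ| := by
      rw [← (hf x₀ hx₀).2, hd x₀ hx₀, norm_mul, norm_phase, mul_one]
    have hκ' : |κ| ≠ 0 := abs_ne_zero.mpr hκ
    have hP0 : conj P ≠ 0 := by
      intro h0
      rw [h0, norm_zero] at hnP
      exact hκ' hnP.symm
    refine ⟨fun x => f x / conj P, fun x hx => ?_, Or.inr
      ⟨κ, c, d / conj P, |κ| / conj P, hκ, ?_, fun x hx => ?_⟩⟩
    · convert! (h.hasDerivAt hx).div_const (conj P) using 1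
      rw [hd x hx]
      field_simp
    · rw [norm_div, hnP, Complex.norm_real, Real.norm_eq_abs, abs_abs, div_self hκ']
    · have : ((|κ| : ℝ) : ℂ) ≠ 0 := by exact_mod_cast hκ'
      simp only
      rw [(hf x hx).1]
      push_cast
      field_simp

/-! ### Integration of `ψ` and the case `μ ≠ 0` -/

theorem eq_of_partials_zero {Ψ : ℝ → ℝ → ℂ} {a b a' b' : ℝ}
    (h0 : ∀ x ∈ Set.Ioo a b, ∀ y ∈ Set.Ioo a' b', HasDerivAt (fun t => Ψ t y) 0 x)
    (h1 : ∀ x ∈ Set.Ioo a b, ∀ y ∈ Set.Ioo a' b', HasDerivAt (fun t => Ψ x t) 0 y)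
    {x₀ y₀ : ℝ} (hx₀ : x₀ ∈ Set.Ioo a b) (hy₀ : y₀ ∈ Set.Ioo a' b') {x y : ℝ}
    (hx : x ∈ Set.Ioo a b) (hy : y ∈ Set.Ioo a' b') : Ψ x y = Ψ x₀ y₀ :=
  (eq_of_hasDerivAt_zero (f := fun t => Ψ t y) (fun t ht => h0 t ht y hy) hx hx₀).trans
    (eq_of_hasDerivAt_zero (f := fun t => Ψ x₀ t) (fun t ht => h1 x₀ hx₀ t ht) hy hy₀)

/-- An angle in `[0, π)` covers only half of the directions; the sign covers the other half and
decides which of the two profiles yields `α`. -/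
theorem exists_angle {μ : ℂ} (hμ : μ ≠ 0) : ∃ ρ : ℝ, 0 < ρ ∧ ∃ ϕ ∈ Set.Ico 0 Real.pi,
    μ = -(ρ ^ 2 * Complex.exp (ϕ * Complex.I)) ∨ μ = ρ ^ 2 * Complex.exp (ϕ * Complex.I) := by
  have hρ : 0 < ‖μ‖ := norm_pos_iff.mpr hμ
  have hs : ((Real.sqrt ‖μ‖ : ℝ) : ℂ) ^ 2 = (‖μ‖ : ℝ) := by
    rw [← Complex.ofReal_pow, Real.sq_sqrt hρ.le]
  refine ⟨Real.sqrt ‖μ‖, Real.sqrt_pos.mpr hρ, ?_⟩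
  rw [hs]
  have hpolar := Complex.norm_mul_exp_arg_mul_I μ
  have h1 := Complex.neg_pi_lt_arg μ
  have h2 := Complex.arg_le_pi μ
  by_cases h3 : 0 ≤ μ.arg
  · rcases h2.lt_or_eq with h4 | h4
    · exact ⟨μ.arg, ⟨h3, h4⟩, Or.inr hpolar.symm⟩
    · refine ⟨0, ⟨le_rfl, Real.pi_pos⟩, Or.inl ?_⟩
      rw [h4, Complex.exp_pi_mul_I] at hpolar
      simpa using hpolar.symm
  · push Not at h3
    refine ⟨μ.arg + Real.pi, ⟨by linarith, by linarith⟩, Or.inl ?_⟩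
    push_cast
    rw [add_mul, Complex.exp_add, Complex.exp_pi_mul_I]
    linear_combination -hpolar

theorem norm_crossVector (e : C2) : ‖crossVector e‖ = ‖e‖ := by
  simp [EuclideanSpace.norm_eq, crossVector, Fin.sum_univ_two, add_comm]

theorem inner_crossVector (e : C2) : inner ℂ e (crossVector e) = 0 := by
  simp [PiLp.inner_apply, crossVector, Fin.sum_univ_two]
  ring

theorem isLocallyStar_of_ne_zero [IsManifold (𝓡 2) ∞ M] {φ : M → C2}
    {z : OpenPartialHomeomorph M R2} (hz : z ∈ IsManifold.maximalAtlas (𝓡 2) ∞ M)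
    {p : M} (hp : p ∈ z.source) {a b a' b' : ℝ} {f g : ℝ → ℂ} {ψ : R2 → ℂ} {e : C2} {μ c : ℂ}
    (he : e ≠ 0) (hμ : μ ≠ 0) (hc : ‖c‖ = 1) (hx₀ : z p 0 ∈ Set.Ioo a b)
    (hy₀ : z p 1 ∈ Set.Ioo a' b')
    (hf : IsProfile μ (Set.Ioo a b) f) (hg : IsProfile (-μ) (Set.Ioo a' b') g)
    (h0 : ∀ x ∈ Set.Ioo a b, ∀ y ∈ Set.Ioo a' b',
      HasDerivAt (fun t : ℝ => ψ !₂[t, y]) (-c * (phase f x * amplitude g y)) x)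
    (h1 : ∀ x ∈ Set.Ioo a b, ∀ y ∈ Set.Ioo a' b',
      HasDerivAt (fun t : ℝ => ψ !₂[x, t]) (c * (amplitude f x * phase g y)) y)
    (hX : ∀ u ∈ box (Set.Ioo a b) (Set.Ioo a' b'), (‖e‖ ^ 2 : ℝ) • φ (z.symm u) =
      (f (u 0) + g (u 1)) • e + ψ u • crossVector e) :
    IsLocallyStar φ p := by
  have hn : 0 < ‖e‖ := norm_pos_iff.mpr he
  have hμ' : conj μ ≠ 0 := by simpa using hμ
  -- The partial derivatives of `A_f A_g` are `conj μ` times `phase f · A_g` and `-conj μ` times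
  -- `A_f · phase g`, so `-c / conj μ` times this product has the gradient of `ψ`.
  obtain ⟨d, hd⟩ : ∃ d, ∀ x ∈ Set.Ioo a b, ∀ y ∈ Set.Ioo a' b',
      ψ !₂[x, y] = -c / conj μ * (amplitude f x * amplitude g y) + d := by
    refine ⟨ψ !₂[z p 0, z p 1] + c / conj μ * (amplitude f (z p 0) * amplitude g (z p 1)),
      fun x hx y hy => ?_⟩
    have := eq_of_partials_zero
      (Ψ := fun x y => ψ !₂[x, y] + c / conj μ * (amplitude f x * amplitude g y))
      (fun x hx y hy => ?_) (fun x hx y hy => ?_) hx₀ hy₀ hx hy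
    · linear_combination this
    · convert! (h0 x hx y hy).fun_add
        (((hf.hasDerivAt_amplitude hx).mul_const (amplitude g y)).const_mul (c / conj μ)) using 1
      field_simp
      ring
    · convert! (h1 x hx y hy).fun_add
        (((hg.hasDerivAt_amplitude hy).const_mul (amplitude f x)).const_mul (c / conj μ)) using 1
      rw [map_neg]
      field_simp
      ring
  obtain ⟨ρ, hρ, ϕ, hϕ, hcase⟩ := exists_angle hμ
  have hρ' : (ρ : ℂ) ≠ 0 := by exact_mod_cast hρ.ne'
  have hnμ : ‖conj μ‖ = ρ ^ 2 := by
    rw [RCLike.norm_conj]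
    rcases hcase with h | h <;> simp [h, Complex.norm_exp_ofReal_mul_I]
  -- The unimodular part of `-c / conj μ`, absorbed in the second basis vector; the remaining factor
  -- `1 / ρ ^ 2` belongs to the rescaled amplitudes.
  set ζ : ℂ := -c * ρ ^ 2 / conj μ with hζ
  have hζn : ‖ζ‖ = 1 := by
    rw [hζ, norm_div, hnμ, norm_mul, norm_neg, hc, norm_pow, Complex.norm_real, Real.norm_eq_abs,
      sq_abs, one_mul, div_self (by positivity)]
  have hv : ‖(‖e‖⁻¹ : ℝ) • e‖ = 1 := by
    rw [norm_smul, norm_inv, norm_norm, inv_mul_cancel₀ hn.ne']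
  have hw : ‖ζ • (‖e‖⁻¹ : ℝ) • crossVector e‖ = 1 := by
    rw [norm_smul, hζn, norm_smul, norm_inv, norm_norm, norm_crossVector, inv_mul_cancel₀ hn.ne',
      one_mul]
  have hvw : inner ℂ ((‖e‖⁻¹ : ℝ) • e) (ζ • (‖e‖⁻¹ : ℝ) • crossVector e) = 0 := by
    simp only [← Complex.coe_smul, inner_smul_left, inner_smul_right, inner_crossVector, mul_zero]
  have hXu : ∀ u ∈ box (Set.Ioo a b) (Set.Ioo a' b'), φ (z.symm u) =
      (‖e‖⁻¹ : ℝ) • ((f (u 0) + g (u 1)) • ((‖e‖⁻¹ : ℝ) • e) +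
        (amplitude f (u 0) * amplitude g (u 1) / ρ ^ 2) • (ζ • (‖e‖⁻¹ : ℝ) • crossVector e)) +
        (‖e‖⁻¹ : ℝ) • (‖e‖⁻¹ : ℝ) • (d • crossVector e) := by
    intro u hu
    have h2 := hX u hu
    have h3 := hd _ hu.1 _ hu.2
    rw [← eq_mk u] at h3
    rw [h3] at h2
    have h4 : φ (z.symm u) = (‖e‖⁻¹ : ℝ) • (‖e‖⁻¹ : ℝ) • ((‖e‖ ^ 2 : ℝ) • φ (z.symm u)) := by
      rw [smul_smul, smul_smul]
      field_simp
      rw [one_smul]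
    have h5 : amplitude f (u 0) * amplitude g (u 1) / ρ ^ 2 * ζ =
        -c / conj μ * (amplitude f (u 0) * amplitude g (u 1)) := by
      rw [hζ]; field_simp
    rw [h4, h2, ← h5]
    module
  have hbox := isOpen_box (I := Set.Ioo a b) (J := Set.Ioo a' b') isOpen_Ioo isOpen_Ioo
  rcases hcase with hμe | hμe
  · refine isLocallyStar_of_profiles hz hp hbox ⟨hx₀, hy₀⟩ 1 hϕ hρ (f := f) (g := g)
      (hμe ▸ hf) (by rw [hμe, neg_neg] at hg; exact hg) hv hw hvw (inv_pos.mpr hn)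
      fun u hu => ⟨hu.1, hu.2, hXu u hu⟩
  -- With the opposite sign of `μ` the profile `g` plays the role of the first curve; the formula
  -- for the surface is symmetric in the two.
  · refine isLocallyStar_of_profiles hz hp hbox ⟨hx₀, hy₀⟩ (Equiv.swap 0 1) hϕ hρ (f := g) (g := f)
      (hμe ▸ hg) (hμe ▸ hf) hv hw hvw (inv_pos.mpr hn)
      (B := (‖e‖⁻¹ : ℝ) • (‖e‖⁻¹ : ℝ) • (d • crossVector e)) fun u hu => ?_
    rw [Equiv.swap_apply_left, Equiv.swap_apply_right]
    refine ⟨hu.2, hu.1, ?_⟩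
    rw [hXu u hu, add_comm (f _), mul_comm (amplitude f _)]

/-! ### Planes and products of grim reapers -/

theorem isSolitonCurve_line {a : ℝ} : IsSolitonCurve a 0 (Set.Ioi 0) (fun t => (t : ℂ)) 0 := by
  have hd : deriv (fun t : ℝ => (t : ℂ)) = fun _ => 1 := by
    funext t
    exact Complex.ofRealCLM.hasDerivAt.deriv
  refine ⟨isOpen_Ioi, Set.ordConnected_Ioi, Complex.ofRealCLM.contDiff.contDiffOn, ?_, ?_,
    continuousOn_const, ?_⟩
  · simp [hd]
  · intro t _
    simp [hd, normalComp, dot]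
  · simp [hd]

/-- For `ϕ = 0` and both curves the positive half-line, `α ∗ w` is `((s² - t²) / 2, t s)`, the real
and imaginary parts of `(s + i t)² / 2`. It parametrizes an open half of a Lagrangian plane, and a
complex square root supplies the coordinates. -/
theorem isLocallyStar_of_plane [IsManifold (𝓡 2) ∞ M] {φ : M → C2}
    {z : OpenPartialHomeomorph M R2} (hz : z ∈ IsManifold.maximalAtlas (𝓡 2) ∞ M)
    {p : M} (hp : p ∈ z.source) {S : Set R2} (hS : IsOpen S) (hpS : z p ∈ S)
    {v w B : C2} (hv : ‖v‖ = 1) (hw : ‖w‖ = 1) (hvw : inner ℂ v w = 0) {r : ℝ} (hr : 0 < r)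
    (h : ∀ u ∈ S, φ (z.symm u) = r • ((u 0 : ℂ) • v + (u 1 : ℂ) • w) + B) :
    IsLocallyStar φ p := by
  obtain ⟨U, hU⟩ := exists_unitary hv hw hvw
  have c1 : IsSolitonCurve (-Real.cos 0) (Real.sin 0) (Set.Ioi 0) (fun t => (t : ℂ)) 0 := by
    rw [Real.sin_zero]; exact isSolitonCurve_line
  have c2 : IsSolitonCurve (Real.cos 0) (-Real.sin 0) (Set.Ioi 0) (fun t => (t : ℂ)) 0 := by
    rw [Real.sin_zero, neg_zero]; exact isSolitonCurve_line
  refine ⟨0, ⟨le_rfl, Real.pi_pos⟩, _, _, _, _, _, _, 1, 1, c1, c2,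
    Set.mem_Ioi.mpr one_pos, Set.mem_Ioi.mpr one_pos, ?_⟩
  -- The shift puts `p` at height `1`, inside the upper half-plane where the square root is smooth;
  -- the translation of the congruence undoes it.
  set q : ℝ := z p 1 - 1 with hq
  have hS' : IsOpen (S ∩ {u : R2 | q < u 1}) :=
    hS.inter (isOpen_lt continuous_const (contDiff_coord 1).continuous)
  have hlt : ∀ u ∈ S ∩ {u : R2 | q < u 1}, 0 < u 1 - q := fun u hu => sub_pos.mpr hu.2
  have habs : ∀ A B : ℝ, 0 < B → |A| < Real.sqrt (A ^ 2 + B ^ 2) := by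
    intro A B hB
    rw [← Real.sqrt_sq_eq_abs]
    exact Real.sqrt_lt_sqrt (sq_nonneg _) (by have := pow_pos hB 2; linarith)
  have hm : ∀ A B : ℝ, 0 < B → 0 < Real.sqrt (A ^ 2 + B ^ 2) - A := fun A B hB => by
    linarith [habs A B hB, le_abs_self A]
  have hpl : ∀ A B : ℝ, 0 < B → 0 < Real.sqrt (A ^ 2 + B ^ 2) + A := fun A B hB => by
    linarith [habs A B hB, neg_abs_le A]
  have hdiff : ∀ A B : ℝ, 0 < B →
      (Real.sqrt (Real.sqrt (A ^ 2 + B ^ 2) + A) ^ 2 -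
        Real.sqrt (Real.sqrt (A ^ 2 + B ^ 2) - A) ^ 2) / 2 = A := by
    intro A B hB
    rw [Real.sq_sqrt (hpl A B hB).le, Real.sq_sqrt (hm A B hB).le]
    ring
  have hprod : ∀ A B : ℝ, 0 < B →
      Real.sqrt (Real.sqrt (A ^ 2 + B ^ 2) - A) *
        Real.sqrt (Real.sqrt (A ^ 2 + B ^ 2) + A) = B := by
    intro A B hB
    rw [← Real.sqrt_mul (hm A B hB).le]
    have : (Real.sqrt (A ^ 2 + B ^ 2) - A) * (Real.sqrt (A ^ 2 + B ^ 2) + A) = B ^ 2 := by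
      have := Real.sq_sqrt (show 0 ≤ A ^ 2 + B ^ 2 by positivity)
      linear_combination this
    rw [this, Real.sqrt_sq hB.le]
  refine locallyCongruentAt_of_coordinate hz hp
    (G := fun u => !₂[Real.sqrt (Real.sqrt (u 0 ^ 2 + (u 1 - q) ^ 2) - u 0),
      Real.sqrt (Real.sqrt (u 0 ^ 2 + (u 1 - q) ^ 2) + u 0)])
    (K := fun v => !₂[(v 1 ^ 2 - v 0 ^ 2) / 2, v 0 * v 1 + q]) (N := box (Set.Ioi 0) (Set.Ioi 0))
    hS' ⟨hpS, by simp [hq]⟩ (isOpen_box isOpen_Ioi isOpen_Ioi) subset_rfl ?_ ?_ ?_ ?_ ?_ r hr U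
    (B + r • (q : ℂ) • w) ?_
  · have c0 : ContDiffOn ℝ ∞ (fun u : R2 => Real.sqrt (u 0 ^ 2 + (u 1 - q) ^ 2))
        (S ∩ {u : R2 | q < u 1}) := by
      refine ContDiffOn.sqrt ?_ fun u hu => ?_
      · exact (((contDiff_coord 0).pow 2).add (((contDiff_coord 1).sub contDiff_const).pow 2)).contDiffOn
      · have : 0 < u 1 - q := hlt u hu
        positivity
    refine contDiffOn_R2 fun i => ?_
    fin_cases i
    · refine ContDiffOn.sqrt (c0.sub (contDiff_coord 0).contDiffOn) fun u hu => ?_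
      exact (hm _ _ (hlt u hu)).ne'
    · refine ContDiffOn.sqrt (c0.add (contDiff_coord 0).contDiffOn) fun u hu => ?_
      exact (hpl _ _ (hlt u hu)).ne'
  · refine contDiffOn_R2 fun i => ContDiff.contDiffOn ?_
    fin_cases i
    · exact (((contDiff_coord 1).pow 2).sub ((contDiff_coord 0).pow 2)).div_const 2
    · exact ((contDiff_coord 0).mul (contDiff_coord 1)).add contDiff_const
  · intro u hu
    exact ⟨Real.sqrt_pos.mpr (hm _ _ (hlt u hu)),
      Real.sqrt_pos.mpr (hpl _ _ (hlt u hu))⟩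
  · intro u hu
    have hu' := hlt u hu
    ext i
    fin_cases i
    · exact hdiff _ _ hu'
    · have := hprod (u 0) (u 1 - q) hu'
      simp [this]
  · intro v hv _
    obtain ⟨h0, h1⟩ := hv
    have h0 : 0 < v 0 := h0
    have h1 : 0 < v 1 := h1
    have e : Real.sqrt (((v 1 ^ 2 - v 0 ^ 2) / 2) ^ 2 + (v 0 * v 1) ^ 2) =
        (v 1 ^ 2 + v 0 ^ 2) / 2 := by
      rw [← Real.sqrt_sq (show 0 ≤ (v 1 ^ 2 + v 0 ^ 2) / 2 by positivity)]
      congr 1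
      ring
    ext i
    fin_cases i
    · simp [e]
      rw [show (v 1 ^ 2 + v 0 ^ 2) / 2 - (v 1 ^ 2 - v 0 ^ 2) / 2 = v 0 ^ 2 by ring,
        Real.sqrt_sq h0.le]
    · simp [e]
      rw [show (v 1 ^ 2 + v 0 ^ 2) / 2 + (v 1 ^ 2 - v 0 ^ 2) / 2 = v 1 ^ 2 by ring,
        Real.sqrt_sq h1.le]
  · intro u hu
    have hu' := hlt u hu
    have hpi : (0 : ℝ) ≠ Real.pi / 2 := by have := Real.pi_pos; positivity
    rw [h u hu.1, starMap, if_neg hpi, hU]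
    have a1 := hdiff (u 0) (u 1 - q) hu'
    have a2 := hprod (u 0) (u 1 - q) hu'
    have e1 : (((‖((Real.sqrt (Real.sqrt (u 0 ^ 2 + (u 1 - q) ^ 2) + u 0) : ℝ) : ℂ)‖ ^ 2 -
        ‖((Real.sqrt (Real.sqrt (u 0 ^ 2 + (u 1 - q) ^ 2) - u 0) : ℝ) : ℂ)‖ ^ 2) /
        (2 * Real.cos 0) : ℝ) : ℂ) = u 0 := by
      rw [Complex.norm_real, Complex.norm_real, Real.norm_eq_abs, Real.norm_eq_abs, sq_abs, sq_abs,
        Real.cos_zero, mul_one, a1]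
    have e2 : ((Real.sqrt (Real.sqrt (u 0 ^ 2 + (u 1 - q) ^ 2) - u 0) : ℝ) : ℂ) *
        ((Real.sqrt (Real.sqrt (u 0 ^ 2 + (u 1 - q) ^ 2) + u 0) : ℝ) : ℂ) = u 1 - q := by
      rw [← Complex.ofReal_mul, a2, Complex.ofReal_sub]
    simp only [Matrix.cons_val_zero, Matrix.cons_val_one, e1, e2]
    simp only [Pi.zero_apply, add_zero, Complex.ofReal_zero, mul_zero]
    module

/-- A sum of two profile primitives along orthonormal directions. -/
theorem locallyCongruentAt_of_product [IsManifold (𝓡 2) ∞ M] {φ : M → C2}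
    {z : OpenPartialHomeomorph M R2} (hz : z ∈ IsManifold.maximalAtlas (𝓡 2) ∞ M)
    {p : M} (hp : p ∈ z.source) {a b a' b' : ℝ} (hx₀ : z p 0 ∈ Set.Ioo a b)
    (hy₀ : z p 1 ∈ Set.Ioo a' b') {h k : ℝ → ℂ}
    (hh : (∃ w : ℂ, ‖w‖ = 1 ∧ ∀ x : ℝ, h x = x * w) ∨
        ∃ (κ c : ℝ) (d w : ℂ), κ ≠ 0 ∧ ‖w‖ = 1 ∧ ∀ x ∈ Set.Ioo a b,
          h x = (|κ|⁻¹ : ℝ) * grimReaper (κ * x + c) * w + d)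
    (hk : (∃ w : ℂ, ‖w‖ = 1 ∧ ∀ x : ℝ, k x = x * w) ∨
        ∃ (κ c : ℝ) (d w : ℂ), κ ≠ 0 ∧ ‖w‖ = 1 ∧ ∀ x ∈ Set.Ioo a' b',
          k x = (|κ|⁻¹ : ℝ) * grimReaper (κ * x + c) * w + d)
    {v w B : C2} (hv : ‖v‖ = 1) (hw : ‖w‖ = 1) (hvw : inner ℂ v w = 0) {r : ℝ} (hr : 0 < r)
    (hX : ∀ u ∈ box (Set.Ioo a b) (Set.Ioo a' b'),
      φ (z.symm u) = r • (h (u 0) • v + k (u 1) • w) + B) :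
    LocallyCongruentAt φ p Set.univ grimReaperLine ∨
      (∃ a₁ a₂ : ℝ, 0 < a₁ ∧ 0 < a₂ ∧
        LocallyCongruentAt φ p Set.univ (grimReaperProduct a₁ a₂)) ∨ IsLocallyStar φ p := by
  have hbox := isOpen_box (I := Set.Ioo a b) (J := Set.Ioo a' b') isOpen_Ioo isOpen_Ioo
  have key : ∀ {w₁ w₂ : ℂ}, ‖w₁‖ = 1 → ‖w₂‖ = 1 →
      ‖w₁ • v‖ = 1 ∧ ‖w₂ • w‖ = 1 ∧ inner ℂ (w₁ • v) (w₂ • w) = 0 := by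
    intro w₁ w₂ h1 h2
    rw [norm_smul, norm_smul, inner_smul_left, inner_smul_right, h1, h2, hv, hw, hvw]
    simp
  rcases hh with ⟨w₁, hw₁, hh⟩ | ⟨κ₁, c₁, d₁, w₁, hκ₁, hw₁, hh⟩ <;>
  rcases hk with ⟨w₂, hw₂, hk⟩ | ⟨κ₂, c₂, d₂, w₂, hκ₂, hw₂, hk⟩ <;>
  obtain ⟨n1, n2, n3⟩ := key hw₁ hw₂
  · refine Or.inr (Or.inr (isLocallyStar_of_plane hz hp hbox ⟨hx₀, hy₀⟩ n1 n2 n3 hr (B := B)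
      fun u hu => ?_))
    rw [hX u hu, hh, hk]
    module
  · obtain ⟨U, hU⟩ := exists_unitary n2 n1 (inner_eq_zero_symm.mp n3)
    have hp' : 0 < |κ₂| := abs_pos.mpr hκ₂
    -- The dilation `|κ₂|⁻¹` fits the grim reaper; scaling the line's parameter by `|κ₂|` undoes it
    -- there. The sign of `κ₂` stays in the parameter, and the swap puts the grim reaper first.
    refine Or.inl (locallyCongruentAt_of_affine hz hp hbox ⟨hx₀, hy₀⟩ isOpen_univ (Equiv.swap 0 1)
      (k := ![κ₂, |κ₂|]) (c := ![c₂, 0]) (r := r * |κ₂|⁻¹) ?_ (by positivity) U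
      (r • d₂ • w + B) fun u hu => ⟨Set.mem_univ _, ?_⟩)
    · intro i; fin_cases i
      · exact hκ₂
      · exact hp'.ne'
    · rw [hX u hu, hh, hk _ hu.2, grimReaperLine, hU]
      simp only [Matrix.cons_val_zero, Matrix.cons_val_one, Equiv.swap_apply_left,
        Equiv.swap_apply_right, add_zero]
      have e : (u 0 : ℂ) = (|κ₂|⁻¹ : ℝ) * ((|κ₂| * u 0 : ℝ) : ℂ) := by
        rw [← Complex.ofReal_mul]
        congr 1
        field_simp
      rw [e]
      simp only [← Complex.coe_smul]
      push_cast
      module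
  · obtain ⟨U, hU⟩ := exists_unitary n1 n2 n3
    have hp' : 0 < |κ₁| := abs_pos.mpr hκ₁
    refine Or.inl (locallyCongruentAt_of_affine hz hp hbox ⟨hx₀, hy₀⟩ isOpen_univ 1
      (k := ![κ₁, |κ₁|]) (c := ![c₁, 0]) (r := r * |κ₁|⁻¹) ?_ (by positivity) U
      (r • d₁ • v + B) fun u hu => ⟨Set.mem_univ _, ?_⟩)
    · intro i; fin_cases i
      · exact hκ₁
      · exact hp'.ne'
    · rw [hX u hu, hh _ hu.1, hk, grimReaperLine, hU]
      simp only [Matrix.cons_val_zero, Matrix.cons_val_one, Equiv.Perm.one_apply, add_zero]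
      have e : (u 1 : ℂ) = (|κ₁|⁻¹ : ℝ) * ((|κ₁| * u 1 : ℝ) : ℂ) := by
        rw [← Complex.ofReal_mul]
        congr 1
        field_simp
      rw [e]
      simp only [← Complex.coe_smul]
      push_cast
      module
  · obtain ⟨U, hU⟩ := exists_unitary n1 n2 n3
    have hp₁ : 0 < |κ₁| := abs_pos.mpr hκ₁
    have hp₂ : 0 < |κ₂| := abs_pos.mpr hκ₂
    refine Or.inr (Or.inl ⟨|κ₁|⁻¹, |κ₂|⁻¹, by positivity, by positivity,
      locallyCongruentAt_of_affine hz hp hbox ⟨hx₀, hy₀⟩ isOpen_univ 1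
      (k := ![κ₁, κ₂]) (c := ![c₁, c₂]) ?_ hr U
      (r • d₁ • v + r • d₂ • w + B) fun u hu => ⟨Set.mem_univ _, ?_⟩⟩)
    · intro i; fin_cases i
      · exact hκ₁
      · exact hκ₂
    · rw [hX u hu, hh _ hu.1, hk _ hu.2, grimReaperProduct, hU]
      simp only [Matrix.cons_val_zero, Matrix.cons_val_one, Equiv.Perm.one_apply,
        Complex.real_smul]
      module

/-- With constant amplitudes `P`, `Q`, one has `f' = conj P · phase f` and `g' = conj Q · phase g`,
and the gradient of `ψ` also splits into multiples of the phases. Collecting the coefficients of the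
primitives `h`, `k` gives vectors `V`, `W`, which `|c| = 1` makes orthogonal and of the same length.
-/
theorem locallyCongruentAt_of_eq_zero [IsManifold (𝓡 2) ∞ M] {φ : M → C2}
    {z : OpenPartialHomeomorph M R2} (hz : z ∈ IsManifold.maximalAtlas (𝓡 2) ∞ M)
    {p : M} (hp : p ∈ z.source) {a b a' b' : ℝ} {f g : ℝ → ℂ} {ψ : R2 → ℂ} {e : C2} {c : ℂ}
    (he : e ≠ 0) (hc : ‖c‖ = 1) (hx₀ : z p 0 ∈ Set.Ioo a b) (hy₀ : z p 1 ∈ Set.Ioo a' b')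
    (hf : IsProfile 0 (Set.Ioo a b) f) (hg : IsProfile 0 (Set.Ioo a' b') g)
    (hfg : deriv f (z p 0) ≠ 0 ∨ deriv g (z p 1) ≠ 0)
    (h0 : ∀ x ∈ Set.Ioo a b, ∀ y ∈ Set.Ioo a' b',
      HasDerivAt (fun t : ℝ => ψ !₂[t, y]) (-c * (phase f x * amplitude g y)) x)
    (h1 : ∀ x ∈ Set.Ioo a b, ∀ y ∈ Set.Ioo a' b',
      HasDerivAt (fun t : ℝ => ψ !₂[x, t]) (c * (amplitude f x * phase g y)) y)
    (hX : ∀ u ∈ box (Set.Ioo a b) (Set.Ioo a' b'), (‖e‖ ^ 2 : ℝ) • φ (z.symm u) =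
      (f (u 0) + g (u 1)) • e + ψ u • crossVector e) :
    LocallyCongruentAt φ p Set.univ grimReaperLine ∨
      (∃ a₁ a₂ : ℝ, 0 < a₁ ∧ 0 < a₂ ∧
        LocallyCongruentAt φ p Set.univ (grimReaperProduct a₁ a₂)) ∨ IsLocallyStar φ p := by
  have hn : 0 < ‖e‖ := norm_pos_iff.mpr he
  have hconst : ∀ {a b x₀ : ℝ} {f : ℝ → ℂ}, IsProfile 0 (Set.Ioo a b) f → x₀ ∈ Set.Ioo a b →
      ∀ x ∈ Set.Ioo a b, amplitude f x = amplitude f x₀ := by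
    intro a b x₀ f hf hx₀ x hx
    refine eq_of_hasDerivAt_zero (fun t ht => ?_) hx hx₀
    simpa using hf.hasDerivAt_amplitude ht
  have hP := hconst hf hx₀
  have hQ := hconst hg hy₀
  set P := amplitude f (z p 0) with hPdef
  set Q := amplitude g (z p 1) with hQdef
  obtain ⟨h, hh, hh'⟩ := hf.exists_primitive hx₀ hP
  obtain ⟨k, hk, hk'⟩ := hg.exists_primitive hy₀ hQ
  have hprim : ∀ {a b x₀ : ℝ} {f h : ℝ → ℂ} {P : ℂ}, x₀ ∈ Set.Ioo a b →
      IsProfile 0 (Set.Ioo a b) f → (∀ x ∈ Set.Ioo a b, amplitude f x = P) →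
      (∀ x ∈ Set.Ioo a b, HasDerivAt h (phase f x) x) →
      ∃ d, ∀ x ∈ Set.Ioo a b, f x = conj P * h x + d := by
    intro a b x₀ f h P hx₀ hf hP hh
    refine ⟨f x₀ - conj P * h x₀, fun x hx => ?_⟩
    have := eq_of_hasDerivAt_zero (f := fun x => f x - conj P * h x) (fun t ht => ?_) hx hx₀
    · linear_combination this
    · convert! (hf.hasDerivAt ht).fun_sub ((hh t ht).const_mul (conj P)) using 1
      rw [deriv_eq_conj_amplitude, hP t ht, sub_self]
  obtain ⟨d₁, hd₁⟩ := hprim hx₀ hf hP hh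
  obtain ⟨d₂, hd₂⟩ := hprim hy₀ hg hQ hk
  obtain ⟨d₃, hd₃⟩ : ∃ d, ∀ x ∈ Set.Ioo a b, ∀ y ∈ Set.Ioo a' b',
      ψ !₂[x, y] = -(c * Q) * h x + c * P * k y + d := by
    refine ⟨ψ !₂[z p 0, z p 1] - (-(c * Q) * h (z p 0) + c * P * k (z p 1)), fun x hx y hy => ?_⟩
    have := eq_of_partials_zero
      (Ψ := fun x y => ψ !₂[x, y] - (-(c * Q) * h x + c * P * k y))
      (fun x hx y hy => ?_) (fun x hx y hy => ?_) hx₀ hy₀ hx hy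
    · linear_combination this
    · convert! (h0 x hx y hy).fun_sub
        (((hh x hx).const_mul (-(c * Q))).add_const (c * P * k y)) using 1
      rw [hQ y hy]
      ring
    · convert! (h1 x hx y hy).fun_sub
        (((hk y hy).const_mul (c * P)).const_add (-(c * Q) * h x)) using 1
      rw [hP x hx]
      ring
  have hcc : c * conj c = 1 := by
    rw [Complex.mul_conj, Complex.normSq_eq_norm_sq, hc]; simp
  obtain ⟨V, hV⟩ : ∃ V, V = conj P • e - (c * Q) • crossVector e := ⟨_, rfl⟩
  obtain ⟨W, hW⟩ : ∃ W, W = conj Q • e + (c * P) • crossVector e := ⟨_, rfl⟩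
  have io := inner_crossVector e
  have io' : inner ℂ (crossVector e) e = 0 := inner_eq_zero_symm.mp io
  have i1 : inner ℂ e e = (‖e‖ : ℂ) ^ 2 := inner_self_eq_norm_sq_to_K e
  have i2 : inner ℂ (crossVector e) (crossVector e) = (‖e‖ : ℂ) ^ 2 := by
    rw [inner_self_eq_norm_sq_to_K, norm_crossVector]; rfl
  have hVW : inner ℂ V W = 0 := by
    rw [hV, hW]
    simp only [inner_sub_left, inner_add_right, inner_smul_left, inner_smul_right, io, io', i1, i2,
      map_mul, Complex.conj_conj]
    linear_combination (-(conj Q * P * ‖e‖ ^ 2)) * hcc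
  have hVV : inner ℂ V V = ((‖P‖ ^ 2 + ‖Q‖ ^ 2) * ‖e‖ ^ 2 : ℝ) := by
    rw [hV]
    simp only [inner_sub_left, inner_sub_right, inner_smul_left, inner_smul_right, io, io', i1, i2,
      map_mul, Complex.conj_conj]
    push_cast
    rw [← Complex.conj_mul', ← Complex.conj_mul']
    linear_combination (conj Q * Q * ‖e‖ ^ 2) * hcc
  have hWW : inner ℂ W W = ((‖P‖ ^ 2 + ‖Q‖ ^ 2) * ‖e‖ ^ 2 : ℝ) := by
    rw [hW]
    simp only [inner_add_left, inner_add_right, inner_smul_left, inner_smul_right, io, io', i1, i2,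
      map_mul, Complex.conj_conj]
    push_cast
    rw [← Complex.conj_mul', ← Complex.conj_mul']
    linear_combination (conj P * P * ‖e‖ ^ 2) * hcc
  -- By the immersion condition `f'` and `g'` do not both vanish at the base point, so `P` and `Q`
  -- are not both zero.
  have hPQ : 0 < (‖P‖ ^ 2 + ‖Q‖ ^ 2) * ‖e‖ ^ 2 := by
    have h2 : 0 < ‖P‖ ^ 2 + ‖Q‖ ^ 2 := by
      rcases hfg with h2 | h2 <;> rw [deriv_eq_conj_amplitude] at h2
      · have : P ≠ 0 := fun h3 => h2 (by rw [← hPdef, h3]; simp)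
        have := norm_pos_iff.mpr this
        positivity
      · have : Q ≠ 0 := fun h3 => h2 (by rw [← hQdef, h3]; simp)
        have := norm_pos_iff.mpr this
        positivity
    positivity
  have hnorm : ∀ {V : C2} {s : ℝ}, inner ℂ V V = (s : ℂ) → ‖V‖ = Real.sqrt s := by
    intro V s hs
    rw [inner_self_eq_norm_sq_to_K] at hs
    have : ‖V‖ ^ 2 = s := Complex.ofReal_injective (by rw [← hs]; push_cast; rfl)
    rw [← this, Real.sqrt_sq (norm_nonneg _)]
  have hVn := hnorm hVV
  have hWn := hnorm hWW
  set N := Real.sqrt ((‖P‖ ^ 2 + ‖Q‖ ^ 2) * ‖e‖ ^ 2) with hN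
  have hNpos : 0 < N := Real.sqrt_pos.mpr hPQ
  refine locallyCongruentAt_of_product hz hp hx₀ hy₀ hh' hk' (v := (N⁻¹ : ℝ) • V)
    (w := (N⁻¹ : ℝ) • W)
    (B := ((‖e‖ ^ 2)⁻¹ : ℝ) • ((d₁ + d₂) • e + d₃ • crossVector e)) ?_ ?_ ?_
    (r := N / ‖e‖ ^ 2) (by positivity) fun u hu => ?_
  · rw [norm_smul, hVn, norm_inv, Real.norm_eq_abs, abs_of_pos hNpos, inv_mul_cancel₀ hNpos.ne']
  · rw [norm_smul, hWn, norm_inv, Real.norm_eq_abs, abs_of_pos hNpos, inv_mul_cancel₀ hNpos.ne']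
  · simp only [← Complex.coe_smul, inner_smul_left, inner_smul_right, hVW, mul_zero]
  · have h2 := hX u hu
    have h3 := hd₃ _ hu.1 _ hu.2
    rw [← eq_mk u] at h3
    rw [h3, hd₁ _ hu.1, hd₂ _ hu.2] at h2
    have h4 : φ (z.symm u) = ((‖e‖ ^ 2)⁻¹ : ℝ) • ((‖e‖ ^ 2 : ℝ) • φ (z.symm u)) := by
      rw [smul_smul, inv_mul_cancel₀ (by positivity), one_smul]
    have h5 : ∀ x : C2, (N / ‖e‖ ^ 2) • x = ((‖e‖ ^ 2)⁻¹ : ℝ) • N • x := by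
      intro x; rw [smul_smul]; congr 1; ring
    have h6 : N • (h (u 0) • (N⁻¹ : ℝ) • V + k (u 1) • (N⁻¹ : ℝ) • W) =
        h (u 0) • V + k (u 1) • W := by
      rw [smul_add, smul_comm (h (u 0)), smul_comm (k (u 1)), smul_inv_smul₀ hNpos.ne',
        smul_inv_smul₀ hNpos.ne']
    rw [h4, h2, h5, h6, hV, hW]
    module

end LagrangianSoliton

theorem theorem1 {M : Type*} [TopologicalSpace M] [ChartedSpace R2 M] [IsManifold (𝓡 2) ∞ M]
    (φ : M → C2) (e : C2) (hφ : IsLagrangianImmersion φ) (hsol : IsTranslatingSoliton φ e)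
    (z : OpenPartialHomeomorph M R2) (hz : IsIsothermal φ z)
    (hsep : ∀ u ∈ z.target, pd 0 (pd 1 (fun v => herm (φ (z.symm v)) e)) u = 0) :
    ∀ p ∈ z.source,
      LocallyCongruentAt φ p Set.univ grimReaperLine ∨
      (∃ a₁ a₂ : ℝ, 0 < a₁ ∧ 0 < a₂ ∧
        LocallyCongruentAt φ p Set.univ (grimReaperProduct a₁ a₂)) ∨
      (∃ ϕ ∈ Set.Ico (0 : ℝ) Real.pi,
        ∃ (I₁ I₂ : Set ℝ) (α w : ℝ → ℂ) (ξ ϑ : ℝ → ℝ) (t₀ s₀ : ℝ),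
          IsSolitonCurve (-Real.cos ϕ) (Real.sin ϕ) I₁ α ξ ∧
          IsSolitonCurve (Real.cos ϕ) (-Real.sin ϕ) I₂ w ϑ ∧
          t₀ ∈ I₁ ∧ s₀ ∈ I₂ ∧
          LocallyCongruentAt φ p {u | u 0 ∈ I₁ ∧ u 1 ∈ I₂}
            (starMap ϕ α w ξ ϑ t₀ s₀)) := by
  intro p hp
  obtain ⟨ε, hε, f, g, μ, c, -, hf, hg, hc, h⟩ :=
    (isSeparatedPair_of_soliton hφ hsol hz hsep).exists_profiles (z.map_source hp)
  have hx₀ : z p 0 ∈ Set.Ioo (z p 0 - ε) (z p 0 + ε) := ⟨by linarith, by linarith⟩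
  have hy₀ : z p 1 ∈ Set.Ioo (z p 1 - ε) (z p 1 + ε) := ⟨by linarith, by linarith⟩
  have hX : ∀ u ∈ box (Set.Ioo (z p 0 - ε) (z p 0 + ε)) (Set.Ioo (z p 1 - ε) (z p 1 + ε)),
      (‖e‖ ^ 2 : ℝ) • φ (z.symm u) =
      (f (u 0) + g (u 1)) • e + herm (φ (z.symm u)) (crossVector e) • crossVector e := by
    intro u hu
    have h1 := (h _ hu.1 _ hu.2).1
    rw [← eq_mk u] at h1
    rw [← h1]
    exact norm_sq_smul_eq e _
  by_cases hμ : μ = 0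
  · subst hμ
    rw [neg_zero] at hg
    exact locallyCongruentAt_of_eq_zero hz.mem_atlas hp hsol.ne_zero hc hx₀ hy₀ hf hg
      (h _ hx₀ _ hy₀).2.1 (fun x hx y hy => (h x hx y hy).2.2.1)
      (fun x hx y hy => (h x hx y hy).2.2.2) hX
  · exact Or.inr (Or.inr (isLocallyStar_of_ne_zero hz.mem_atlas hp hsol.ne_zero hμ hc hx₀ hy₀ hf hg
      (fun x hx y hy => (h x hx y hy).2.2.1) (fun x hx y hy => (h x hx y hy).2.2.2) hX))
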